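/- Strings are finite words over $\Sigma=\{0,1\}$, and tuples of strings are coded in the standard way as single strings, so that polynomial-time (Turing machine) computability of functions of several strings makes sense. A set $A\subseteq\Sigma^*$ is P-selective if there is a polynomial-time computable function $f$ such that for all $x,y\in\Sigma^*$ we have $f(x,y)\in\{x,y\}$, and $f(x,y)\in A$ whenever $x\in A$ or $y\in A$; P-Sel is the class of P-selective sets. For a constant $k\ge 1$, P-mc$(k)$ is the class of sets $A\subseteq\Sigma^*$ for which there is a polynomial-time computable function $f$ such that, for every $m\ge k$ and all $z_1,\dots,z_m\in\Sigma^*$, $f(z_1,\dots,z_m)\in\{0,1\}^m$ and $f(z_1,\dots,z_m)\neq(\chi_A(z_1),\dots,\chi_A(z_m))$, where $\chi_A$ is the characteristic function of $A$. **Theorem.** 1. $\{A\cap B : A,B\in\text{P-Sel}\}\subseteq\text{P-mc}(3)$, but $\{A\cap B : A,B\in\text{P-Sel}\}\not\subseteq\text{P-mc}(2)$. 2. $\{A\cup B : A,B\in\text{P-Sel}\}\subseteq\text{P-mc}(3)$, but $\{A\cup B : A,B\in\text{P-Sel}\}\not\subseteq\text{P-mc}(2)$. 3. $\{(A\cap\overline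 B)\cup(\overline A\cap B) : A,B\in\text{P-Sel}\}\not\subseteq\text{P-mc}(3)$ and $\{(A\cap B)\cup(\overline A\cap\overline B) : A,B\in\text{P-Sel}\}\not\subseteq\text{P-mc}(3)$, where $\overline{A}=\Sigma^*\setminus A$. -/

import Mathlib

namespace Selectivity

/-- Strings over the alphabet `{0,1}`; `false` is the bit 0 and `true` the bit 1. -/
abbrev Str : Type := List Bool

/-- Self-delimiting code of a string: every bit `b` is written `1b`, and a final `0` ends it. -/
def encodeStr : Str → List Bool
  | [] => [false]
  | b :: x => true :: b :: encodeStr x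

/-- The code of a tuple of strings as a single string over `{0,1}`. Its length is
`2 (|z₁| + ⋯ + |zₘ|) + m`. -/
def encodeTuple (zs : List Str) : Str := zs.flatMap encodeStr

theorem encodeStr_append_inj : ∀ {x y : Str} {u v : List Bool},
    encodeStr x ++ u = encodeStr y ++ v → x = y ∧ u = v
  | [], [], _, _, h => by simpa [encodeStr] using h
  | [], _ :: _, _, _, h => by simp [encodeStr] at h
  | _ :: _, [], _, _, h => by simp [encodeStr] at h
  | a :: x, b :: y, u, v, h => by
    simp only [encodeStr, List.cons_append, List.cons.injEq, true_and] at h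
    obtain ⟨hx, hu⟩ := encodeStr_append_inj h.2
    exact ⟨by rw [h.1, hx], hu⟩

/-- Different tuples, of whatever lengths, have different codes. -/
theorem encodeTuple_injective : Function.Injective encodeTuple := by
  intro zs
  induction zs with
  | nil =>
    intro ws h
    cases ws with
    | nil => rfl
    | cons w ws => cases w <;> simp [encodeTuple, encodeStr] at h
  | cons z zs ih =>
    intro ws h
    cases ws with
    | nil => cases z <;> simp [encodeTuple, encodeStr] at h
    | cons w ws =>
      simp only [encodeTuple, List.flatMap_cons] at h
      obtain ⟨h1, h2⟩ := encodeStr_append_inj h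
      rw [h1, ih h2]

/-- A function from tuples of strings to strings is polynomial-time computable if some
deterministic Turing machine, started on the code of any tuple, halts with the value as its
output within a number of steps that is polynomial in the length of the code. -/
def PolyTimeComputable (f : List Str → Str) : Prop :=
  Nonempty (Turing.TM2ComputableInPolyTime encodeTuple (id : Str → List Bool) f)

/-- The same for functions of two strings, the input `(x, y)` being the coded pair. -/
def PolyTimeComputable₂ (f : Str × Str → Str) : Prop :=
  Nonempty (Turing.TM2ComputableInPolyTime (fun p : Str × Str => encodeTuple [p.1, p.2])
    (id : Str → List Bool) f)

/-- `f` is a selector for `A`: it outputs one of its two inputs, and its output lies in `A`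
if at least one of the inputs does. -/
def IsSelector (f : Str × Str → Str) (A : Set Str) : Prop :=
  ∀ x y : Str, (f (x, y) = x ∨ f (x, y) = y) ∧ (x ∈ A ∨ y ∈ A → f (x, y) ∈ A)

/-- The class P-Sel of P-selective sets. -/
def PSel : Set (Set Str) :=
  {A | ∃ f : Str × Str → Str, PolyTimeComputable₂ f ∧ IsSelector f A}

open Classical in
/-- The string `χ_A(z₁) ⋯ χ_A(zₘ)`. -/
noncomputable def charString (A : Set Str) (zs : List Str) : Str :=
  zs.map fun z => decide (z ∈ A)

/-- `max {|z₁|, …, |zₘ|}`. -/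
def maxLength (zs : List Str) : ℕ := (zs.map List.length).foldr max 0

/-- `f` is a `g`-membership-comparing function for `A`: on every tuple `z₁, …, zₘ`
(repetitions allowed) with `m ≥ g (max |zᵢ|)` it outputs an `m`-bit string that is different from
the characteristic string of the tuple. -/
def IsMembershipComparing (g : ℕ → ℕ) (f : List Str → Str) (A : Set Str) : Prop :=
  ∀ zs : List Str, g (maxLength zs) ≤ zs.length →
    (f zs).length = zs.length ∧ charString A zs ≠ f zs

/-- The class P-mc(`g`) of polynomial-time `g`-membership-comparable sets. (It is used for
monotone, polynomially bounded, polynomial-time computable `g` with positive values.) -/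
def PMc (g : ℕ → ℕ) : Set (Set Str) :=
  {A | ∃ f : List Str → Str, PolyTimeComputable f ∧ IsMembershipComparing g f A}

/-- P-mc(`k`) for a constant `k`. -/
def PMcConst (k : ℕ) : Set (Set Str) := PMc fun _ => k

/-- All intersections `A ∩ B` with `A ∈ 𝒞` and `B ∈ 𝒟`. -/
def interClass (𝒞 𝒟 : Set (Set Str)) : Set (Set Str) :=
  {L | ∃ A ∈ 𝒞, ∃ B ∈ 𝒟, L = A ∩ B}

/-- All unions `A ∪ B` with `A ∈ 𝒞` and `B ∈ 𝒟`. -/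
def unionClass (𝒞 𝒟 : Set (Set Str)) : Set (Set Str) :=
  {L | ∃ A ∈ 𝒞, ∃ B ∈ 𝒟, L = A ∪ B}

/-- All symmetric differences (xor) of `A ∈ 𝒞` and `B ∈ 𝒟`. -/
def xorClass (𝒞 𝒟 : Set (Set Str)) : Set (Set Str) :=
  {L | ∃ A ∈ 𝒞, ∃ B ∈ 𝒟, L = (A ∩ Bᶜ) ∪ (Aᶜ ∩ B)}

/-- All equivalences (nxor) of `A ∈ 𝒞` and `B ∈ 𝒟`. -/
def nxorClass (𝒞 𝒟 : Set (Set Str)) : Set (Set Str) :=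
  {L | ∃ A ∈ 𝒞, ∃ B ∈ 𝒟, L = (A ∩ B) ∪ (Aᶜ ∩ Bᶜ)}

end Selectivity

/-! For the upper bounds, a selector for `A` turns any three strings into a tournament. If exactly
one of them lies outside `A`, that string loses both of its comparisons. A tournament on three
players has at most one such loser, so the tournaments of `A` and `B` together have at most two, and
some position `i` is a loser of neither (`isLoser_nonLoser`). The pattern with a 0 at `i` and 1 at
the other two positions is then impossible for `A ∩ B`: the string at `i` would be missing from `A`
or from `B`, while both others lie in both sets. For `A ∪ B` the argument is dual, with all
comparisons reversed.

The non-inclusions are a diagonalisation with two interleaved cuts. A sequence `R` has an even part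
and an odd part; `cut p R` collects the strings whose part of parity `p` is lexicographically below
that of `R`. Choosing the smaller key is a selector, computable by a finite automaton
(`cut_mem_PSel`). Each block of four bits of `R` sets two independent thresholds for the three
`probes`, which the two parities order differently. In the order of `probes` the two cuts realise
the patterns 000, 100, 110, 111 and 000, 010, 110, 111 respectively. Their xors, and hence their
nxors, are all eight patterns; restricted to the first two probes, their conjunctions and their
disjunctions are all four. So block `n` can be chosen to realise exactly the output of the `n`-th
candidate function (`exists_diagonal_sequence`). `R` need not be computable; it suffices that there
are only countably many candidates (`countable_polyTimeComputable`).

The rest concerns machines: programs that compose and call each other prove polynomial-time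
computability (`polyTimeComputable_of_selectsFirst`, `polyTimeComputable₂_of_scanState`), and
renaming everything by numbers proves countability (`exists_numMachine`). -/

namespace Selectivity

open Turing

/-! ### Programs for stack machines -/

/-- `StepsTo f n a b`: exactly `n` applications of the partial function `f` lead from `a` to `b`. -/
inductive StepsTo {α : Type*} (f : α → Option α) : ℕ → α → α → Prop
  | refl (a : α) : StepsTo f 0 a a
  | head {n : ℕ} {a b c : α} : f a = some b → StepsTo f n b c → StepsTo f (n + 1) a c

namespace StepsTo

variable {α β : Type*} {f : α → Option α} {g : β → Option β}

theorem trans {m n : ℕ} {a b c : α} (h : StepsTo f m a b) (h' : StepsTo f n b c) :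
    StepsTo f (m + n) a c := by
  induction h with
  | refl => simpa using h'
  | head hs _ ih => rw [Nat.add_right_comm]; exact .head hs (ih h')

theorem iff_iterate {n : ℕ} {a b : α} :
    StepsTo f n a b ↔ (flip bind f)^[n] (some a) = some b := by
  have hnone : ∀ n, (flip bind f)^[n] none = none := fun n => by
    induction n with
    | zero => rfl
    | succ n ih => rw [Function.iterate_succ_apply]; exact ih
  constructor
  · intro h
    induction h with
    | refl => rfl
    | head hs _ ih =>
      rw [Function.iterate_succ_apply, ← ih, ← hs]; rfl
  · induction n generalizing a with
    | zero => intro h; cases Option.some.inj h; exact .refl _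
    | succ n ih =>
      intro h
      rw [Function.iterate_succ_apply] at h
      change (flip bind f)^[n] (f a) = some b at h
      cases ha : f a with
      | none => rw [ha, hnone] at h; cases h
      | some c => rw [ha] at h; exact .head ha (ih h)

/-- Transport of a run along a simulation that preserves the number of steps. -/
theorem simulate {R : α → β → Prop}
    (hR : ∀ a b a', R a b → f a = some a' → ∃ b', g b = some b' ∧ R a' b')
    {n : ℕ} {a a' : α} (h : StepsTo f n a a') {b : β} (hab : R a b) :
    ∃ b', StepsTo g n b b' ∧ R a' b' := by
  induction h generalizing b with
  | refl => exact ⟨b, .refl _, hab⟩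
  | head hs _ ih =>
    obtain ⟨b₁, hb₁, hR₁⟩ := hR _ _ _ hab hs
    obtain ⟨b₂, hb₂, hR₂⟩ := ih hR₁
    exact ⟨b₂, .head hb₁ hb₂, hR₂⟩

end StepsTo

/-- A program working on the stacks `Γ` with internal states `σ`; executing `halt` leaves it. -/
structure Program {K : Type} (Γ : K → Type) (σ : Type) where
  /-- The labels. -/
  Λ : Type
  [fintypeLabel : Fintype Λ]
  /-- The label at which the program is entered. -/
  main : Λ
  /-- The statements. -/
  code : Λ → TM2.Stmt Γ Λ σ

attribute [instance] Program.fintypeLabel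

section Programs

variable {K : Type} [DecidableEq K] {Γ : K → Type} {σ : Type}

/-- Entered with state `v` and stacks `S`, the program is left with state `v'` and stacks `S'`
after at most `t` steps. -/
def Program.Runs (P : Program Γ σ) (v : σ) (S : ∀ k, List (Γ k)) (v' : σ)
    (S' : ∀ k, List (Γ k)) (t : ℕ) : Prop :=
  ∃ n ≤ t, StepsTo (TM2.step P.code) n ⟨some P.main, v, S⟩ ⟨none, v', S'⟩

theorem Program.Runs.mono {P : Program Γ σ} {v v' : σ} {S S' : ∀ k, List (Γ k)} {t t' : ℕ}
    (h : P.Runs v S v' S' t) (ht : t ≤ t') : P.Runs v S v' S' t' :=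
  let ⟨n, hn, h⟩ := h
  ⟨n, hn.trans ht, h⟩

/-- Rename the labels of a statement by `g` and replace `halt` by `e`. -/
def relabel {Λ Λ' : Type} (g : Λ → Λ') (e : TM2.Stmt Γ Λ' σ) :
    TM2.Stmt Γ Λ σ → TM2.Stmt Γ Λ' σ
  | .push k f q => .push k f (relabel g e q)
  | .peek k f q => .peek k f (relabel g e q)
  | .pop k f q => .pop k f (relabel g e q)
  | .load a q => .load a (relabel g e q)
  | .branch p q₁ q₂ => .branch p (relabel g e q₁) (relabel g e q₂)
  | .goto l => .goto fun v => g (l v)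
  | .halt => e

theorem stepAux_relabel {Λ Λ' : Type} (g : Λ → Λ') (e : TM2.Stmt Γ Λ' σ) (q : TM2.Stmt Γ Λ σ)
    (v : σ) (S : ∀ k, List (Γ k)) :
    TM2.stepAux (relabel g e q) v S =
      match TM2.stepAux q v S with
      | ⟨some l, v', S'⟩ => ⟨some (g l), v', S'⟩
      | ⟨none, v', S'⟩ => TM2.stepAux e v' S' := by
  induction q generalizing v S with
  | branch p q₁ q₂ ih₁ ih₂ =>
    cases h : p v
    · simp [relabel, h, ih₂]
    · simp [relabel, h, ih₁]
  | _ => simp_all [relabel]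

/-- Sequential composition. -/
def Program.seq (P Q : Program Γ σ) : Program Γ σ where
  Λ := P.Λ ⊕ Q.Λ
  main := .inl P.main
  code
    | .inl l => relabel .inl (.goto fun _ => .inr Q.main) (P.code l)
    | .inr l => relabel .inr .halt (Q.code l)

/-- The jump to `Q` replaces `halt` inside the last step of `P`, so passing control costs no step
and the time bounds simply add. -/
theorem Program.Runs.seq {P Q : Program Γ σ} {v v' v'' : σ} {S S' S'' : ∀ k, List (Γ k)}
    {t t' : ℕ} (hP : P.Runs v S v' S' t) (hQ : Q.Runs v' S' v'' S'' t') :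
    (P.seq Q).Runs v S v'' S'' (t + t') := by
  obtain ⟨n, hn, hP⟩ := hP
  obtain ⟨n', hn', hQ⟩ := hQ
  refine ⟨n + n', Nat.add_le_add hn hn', ?_⟩
  -- A halted configuration of `P` is matched with the entry of `Q`.
  have key₁ := hP.simulate (g := TM2.step (P.seq Q).code)
    (R := fun a b => b = ⟨some (a.l.elim (.inr Q.main) .inl), a.var, a.stk⟩)
    (by
      rintro ⟨_ | l, v, S⟩ _ a' rfl h
      · simp at h
      · refine ⟨_, rfl, ?_⟩
        simp only [TM2.step, Option.some.injEq] at h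
        simp only [Program.seq, Option.elim, stepAux_relabel, h]
        obtain ⟨_ | l', v', S'⟩ := a' <;> simp) rfl
  have key₂ := hQ.simulate (g := TM2.step (P.seq Q).code)
    (R := fun a b => b = ⟨a.l.map .inr, a.var, a.stk⟩)
    (by
      rintro ⟨_ | l, v, S⟩ _ a' rfl h
      · simp at h
      · refine ⟨_, rfl, ?_⟩
        simp only [TM2.step, Option.some.injEq] at h
        simp only [Program.seq, stepAux_relabel, h]
        obtain ⟨_ | l', v', S'⟩ := a' <;> simp) rfl
  obtain ⟨_, h₁, rfl⟩ := key₁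
  obtain ⟨_, h₂, rfl⟩ := key₂
  exact h₁.trans h₂

/-- A program consisting of one statement, which may jump back to its beginning. -/
def Program.single (q : TM2.Stmt Γ Unit σ) : Program Γ σ where
  Λ := Unit
  main := ()
  code _ := q

theorem Program.runs_single_halt {q : TM2.Stmt Γ Unit σ} {v v' : σ} {S S' : ∀ k, List (Γ k)}
    (h : TM2.stepAux q v S = ⟨none, v', S'⟩) : (Program.single q).Runs v S v' S' 1 :=
  ⟨1, le_rfl, .head (show some (TM2.stepAux q v S) = some _ from congrArg some h) (.refl _)⟩

theorem Program.runs_single_loop {q : TM2.Stmt Γ Unit σ} {v v' v'' : σ}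
    {S S' S'' T : ∀ k, List (Γ k)} {t : ℕ} (h : TM2.stepAux q v S = ⟨some (), v', S'⟩)
    (h' : (Program.single q).Runs v' S' v'' S'' t) (hT : S'' = T) :
    (Program.single q).Runs v S v'' T (t + 1) := by
  subst hT
  obtain ⟨n, hn, h'⟩ := h'
  exact ⟨n + 1, Nat.add_le_add_right hn 1, .head (congrArg some h) h'⟩

/-! ### Running a machine inside a larger one -/

section Lift

variable {K₁ σ₁ Λ : Type} [DecidableEq K₁] (i : K₁ → K) (get : σ → σ₁) (set : σ₁ → σ → σ)

/-- Translation of a statement to a larger family of stacks and a larger set of states. -/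
def liftStmt : TM2.Stmt (fun k => Γ (i k)) Λ σ₁ → TM2.Stmt Γ Λ σ
  | .push k f q => .push (i k) (fun v => f (get v)) (liftStmt q)
  | .peek k f q => .peek (i k) (fun v o => set (f (get v) o) v) (liftStmt q)
  | .pop k f q => .pop (i k) (fun v o => set (f (get v) o) v) (liftStmt q)
  | .load a q => .load (fun v => set (a (get v)) v) (liftStmt q)
  | .branch p q₁ q₂ => .branch (fun v => p (get v)) (liftStmt q₁) (liftStmt q₂)
  | .goto l => .goto fun v => l (get v)
  | .halt => .halt

variable {i get set}

/-- The inner state is one component of the outer one: by `hss` successive writes collapse to one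
write into the fixed `v₀`. Only stacks in the range of `i` are touched, so the others keep the
contents given by `S₀`. -/
theorem stepAux_liftStmt (hi : i.Injective) (hgs : ∀ a v, get (set a v) = a)
    (hss : ∀ a b v, set a (set b v) = set a v) (v₀ : σ) (S₀ : ∀ k, List (Γ k))
    (q : TM2.Stmt (fun k => Γ (i k)) Λ σ₁) (v : σ₁) (S : ∀ k, List (Γ (i k)))
    (S' : ∀ k, List (Γ k)) (hS : ∀ k, S' (i k) = S k) (hS₀ : ∀ k ∉ Set.range i, S' k = S₀ k) :
    ∃ T : ∀ k, List (Γ k), TM2.stepAux (liftStmt i get set q) (set v v₀) S' =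
        ⟨(TM2.stepAux q v S).l, set (TM2.stepAux q v S).var v₀, T⟩ ∧
      (∀ k, T (i k) = (TM2.stepAux q v S).stk k) ∧ ∀ k ∉ Set.range i, T k = S₀ k := by
  have upd : ∀ (S : ∀ k, List (Γ (i k))) (S' : ∀ k, List (Γ k)), (∀ k, S' (i k) = S k) →
      (∀ k ∉ Set.range i, S' k = S₀ k) → ∀ (k : K₁) (L : List (Γ (i k))),
      (∀ j, Function.update S' (i k) L (i j) = Function.update S k L j) ∧
        ∀ j ∉ Set.range i, Function.update S' (i k) L j = S₀ j := by
    intro S S' hS hS₀ k L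
    constructor
    · intro j
      rcases eq_or_ne j k with rfl | hj
      · simp
      · rw [Function.update_of_ne hj, Function.update_of_ne (hi.ne hj), hS]
    · rintro j hj
      rw [Function.update_of_ne (by rintro rfl; exact hj ⟨k, rfl⟩), hS₀ j hj]
  induction q generalizing v S S' with
  | push k f q ih =>
    simp only [liftStmt, TM2.stepAux, hgs, hS]
    obtain ⟨h₁, h₂⟩ := upd S S' hS hS₀ k (f v :: S k)
    exact ih _ _ _ h₁ h₂
  | peek k f q ih =>
    simp only [liftStmt, TM2.stepAux, hgs, hS, hss]
    exact ih _ _ _ hS hS₀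
  | pop k f q ih =>
    simp only [liftStmt, TM2.stepAux, hgs, hS, hss]
    obtain ⟨h₁, h₂⟩ := upd S S' hS hS₀ k (S k).tail
    exact ih _ _ _ h₁ h₂
  | load a q ih =>
    simp only [liftStmt, TM2.stepAux, hgs, hss]
    exact ih _ _ _ hS hS₀
  | branch p q₁ q₂ ih₁ ih₂ =>
    simp only [liftStmt, TM2.stepAux, hgs]
    cases p v
    · exact ih₂ _ _ _ hS hS₀
    · exact ih₁ _ _ _ hS hS₀
  | goto l =>
    simp only [liftStmt, TM2.stepAux, hgs]
    exact ⟨S', rfl, hS, hS₀⟩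
  | halt =>
    simp only [liftStmt, TM2.stepAux]
    exact ⟨S', rfl, hS, hS₀⟩

theorem stepsTo_liftStmt (hi : i.Injective) (hgs : ∀ a v, get (set a v) = a)
    (hss : ∀ a b v, set a (set b v) = set a v) {m : Λ → TM2.Stmt (fun k => Γ (i k)) Λ σ₁}
    {l l' : Option Λ} {v v' : σ₁} {S S' : ∀ k, List (Γ (i k))} {n : ℕ}
    (h : StepsTo (TM2.step m) n ⟨l, v, S⟩ ⟨l', v', S'⟩) (v₀ : σ) {T T' : ∀ k, List (Γ k)}
    (hT : ∀ k, T (i k) = S k) (hT' : ∀ k, T' (i k) = S' k)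
    (hTT' : ∀ k ∉ Set.range i, T' k = T k) :
    StepsTo (TM2.step fun l => liftStmt i get set (m l)) n ⟨l, set v v₀, T⟩ ⟨l', set v' v₀, T'⟩ := by
  obtain ⟨⟨l₁, v₁, T₁⟩, h₁, h₂, h₃, h₄, h₅⟩ :=
    h.simulate (g := TM2.step fun l => liftStmt i get set (m l))
    (R := fun a b => b.l = a.l ∧ b.var = set a.var v₀ ∧ (∀ k, b.stk (i k) = a.stk k) ∧
      ∀ k ∉ Set.range i, b.stk k = T k)
    (by
      rintro ⟨_ | l, v, S⟩ ⟨_, _, U⟩ a' ⟨rfl, rfl, h₁, h₂⟩ h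
      · simp at h
      · simp only [TM2.step, Option.some.injEq] at h
        subst h
        obtain ⟨U', hU', h₃, h₄⟩ :=
          stepAux_liftStmt (Γ := Γ) hi hgs hss v₀ T (m l) v S U h₁ h₂
        exact ⟨_, rfl, by rw [hU'], by rw [hU'], by rw [hU']; exact h₃, by rw [hU']; exact h₄⟩)
    (b := ⟨l, set v v₀, T⟩) ⟨rfl, rfl, hT, fun _ _ => rfl⟩
  simp only at h₂ h₃ h₄ h₅
  subst h₂ h₃
  obtain rfl : T₁ = T' := by
    funext k
    by_cases hk : k ∈ Set.range i
    · obtain ⟨k, rfl⟩ := hk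
      rw [h₄, hT']
    · rw [h₅ k hk, hTT' k hk]
  exact h₁

/-- A program run inside a larger family of stacks and a larger set of states. -/
def Program.lift (i : K₁ → K) (get : σ → σ₁) (set : σ₁ → σ → σ)
    (P : Program (fun k => Γ (i k)) σ₁) : Program Γ σ where
  Λ := P.Λ
  main := P.main
  code l := liftStmt i get set (P.code l)

theorem Program.Runs.lift (hi : i.Injective) (hgs : ∀ a v, get (set a v) = a)
    (hss : ∀ a b v, set a (set b v) = set a v) {P : Program (fun k => Γ (i k)) σ₁}
    {v v' : σ₁} {S S' : ∀ k, List (Γ (i k))} {t : ℕ}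
    (h : P.Runs v S v' S' t) (v₀ : σ) {T T' : ∀ k, List (Γ k)}
    (hT : ∀ k, T (i k) = S k) (hT' : ∀ k, T' (i k) = S' k)
    (hTT' : ∀ k ∉ Set.range i, T' k = T k) :
    (P.lift i get set).Runs (set v v₀) T (set v' v₀) T' t :=
  let ⟨n, hn, h⟩ := h
  ⟨n, hn, stepsTo_liftStmt hi hgs hss h v₀ hT hT' hTT'⟩

end Lift

end Programs

/-! ### Bundled machines as programs -/

theorem initList_eq (tm : FinTM2) (s : List (tm.Γ tm.k₀)) :
    initList tm s = ⟨some tm.main, tm.initialState, Function.update (fun _ => []) tm.k₀ s⟩ := by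
  refine congrArg (TM2.Cfg.mk _ _) (funext fun k => ?_)
  by_cases h : k = tm.k₀
  · subst h; simp
  · simp [h]

theorem haltList_eq (tm : FinTM2) (s : List (tm.Γ tm.k₁)) :
    haltList tm s = ⟨none, tm.initialState, Function.update (fun _ => []) tm.k₁ s⟩ := by
  refine congrArg (TM2.Cfg.mk _ _) (funext fun k => ?_)
  by_cases h : k = tm.k₁
  · subst h; simp
  · simp [h]

/-- The program of a bundled machine. -/
def programOf (tm : FinTM2) : Program tm.Γ tm.σ where
  Λ := tm.Λ
  fintypeLabel := tm.ΛFin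
  main := tm.main
  code := tm.m

theorem outputsInTime_iff (tm : FinTM2) (s : List (tm.Γ tm.k₀)) (s' : List (tm.Γ tm.k₁)) (t : ℕ) :
    Nonempty (TM2OutputsInTime tm s (some s') t) ↔
      (programOf tm).Runs tm.initialState (Function.update (fun _ => []) tm.k₀ s)
        tm.initialState (Function.update (fun _ => []) tm.k₁ s') t := by
  constructor
  · rintro ⟨⟨n, h⟩, hn⟩
    refine ⟨n, hn, StepsTo.iff_iterate.2 ?_⟩
    rw [Option.map_some, initList_eq, haltList_eq] at h
    exact h
  · rintro ⟨n, hn, h⟩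
    refine ⟨⟨n, ?_⟩, hn⟩
    rw [Option.map_some, initList_eq, haltList_eq]
    exact StepsTo.iff_iterate.1 h

/-! ### Stacks of bits -/

/-- A stack, with an identification of its alphabet with `Bool`. -/
structure Port {K : Type} (Γ : K → Type) where
  /-- The stack. -/
  k : K
  /-- Its symbols as bits. -/
  e : Γ k ≃ Bool

section Ports

variable {K : Type} [DecidableEq K] {Γ : K → Type} {σ : Type}

/-- The contents of a stack of bits. -/
def bits (S : ∀ k, List (Γ k)) (p : Port Γ) : List Bool := (S p.k).map p.e

/-- Replace the contents of a stack of bits. -/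
def put (S : ∀ k, List (Γ k)) (p : Port Γ) (L : List Bool) : ∀ k, List (Γ k) :=
  Function.update S p.k (L.map p.e.symm)

@[simp] theorem bits_put (S : ∀ k, List (Γ k)) (p : Port Γ) (L : List Bool) :
    bits (put S p L) p = L := by
  simp [bits, put]

theorem bits_put_of_ne (S : ∀ k, List (Γ k)) {p q : Port Γ} (h : q.k ≠ p.k) (L : List Bool) :
    bits (put S p L) q = bits S q := by
  simp [bits, put, h]

@[simp] theorem put_put (S : ∀ k, List (Γ k)) (p : Port Γ) (L L' : List Bool) :
    put (put S p L) p L' = put S p L' := by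
  simp [put]

@[simp] theorem put_bits (S : ∀ k, List (Γ k)) (p : Port Γ) : put S p (bits S p) = S := by
  simp [bits, put]

theorem put_eq_self {S : ∀ k, List (Γ k)} {p : Port Γ} {L : List Bool} (h : bits S p = L) :
    put S p L = S := by
  rw [← h, put_bits]

theorem put_comm (S : ∀ k, List (Γ k)) {p q : Port Γ} (h : p.k ≠ q.k) (L L' : List Bool) :
    put (put S p L) q L' = put (put S q L') p L :=
  Function.update_comm h _ _ _

theorem put_apply_of_ne (S : ∀ k, List (Γ k)) {p : Port Γ} {k : K} (h : k ≠ p.k)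
    (L : List Bool) : put S p L k = S k :=
  Function.update_of_ne h _ _

variable {Λ : Type}

/-- Push a bit. -/
def pushBit (p : Port Γ) (f : σ → Bool) (q : TM2.Stmt Γ Λ σ) : TM2.Stmt Γ Λ σ :=
  .push p.k (fun v => p.e.symm (f v)) q

/-- Pop a bit. -/
def popBit (p : Port Γ) (f : σ → Option Bool → σ) (q : TM2.Stmt Γ Λ σ) : TM2.Stmt Γ Λ σ :=
  .pop p.k (fun v o => f v (o.map p.e)) q

@[simp] theorem stepAux_pushBit (p : Port Γ) (f : σ → Bool) (q : TM2.Stmt Γ Λ σ) (v : σ)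
    (S : ∀ k, List (Γ k)) :
    TM2.stepAux (pushBit p f q) v S = TM2.stepAux q v (put S p (f v :: bits S p)) := by
  simp [pushBit, put, bits]

@[simp] theorem stepAux_popBit (p : Port Γ) (f : σ → Option Bool → σ) (q : TM2.Stmt Γ Λ σ) (v : σ)
    (S : ∀ k, List (Γ k)) :
    TM2.stepAux (popBit p f q) v S =
      TM2.stepAux q (f v (bits S p).head?) (put S p (bits S p).tail) := by
  simp [popBit, put, bits, List.map_tail, List.head?_map]

/-! ### Loops over a stack of bits -/

/-- States with two registers for bits read from stacks. -/
abbrev Regs (E : Type) : Type := Option Bool × Option Bool × E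

variable {E : Type}

/-- Change the state. -/
def modify (f : E → E) : Program Γ (Regs E) :=
  .single <| .load (fun v => (v.1, v.2.1, f v.2.2)) .halt

theorem runs_modify (f : E → E) (e : E) (r r' : Option Bool) (S : ∀ k, List (Γ k)) :
    (modify f).Runs (r, r', e) S (r, r', f e) S 1 :=
  Program.runs_single_halt rfl

/-- Push a bit that depends on the state. -/
def emit (p : Port Γ) (f : E → Bool) : Program Γ (Regs E) :=
  .single <| pushBit p (fun v => f v.2.2) .halt

theorem runs_emit (p : Port Γ) (f : E → Bool) (e : E) (r r' : Option Bool)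
    (S : ∀ k, List (Γ k)) :
    (emit p f).Runs (r, r', e) S (r, r', e) (put S p (f e :: bits S p)) 1 :=
  Program.runs_single_halt (by simp)

/-- Empty the stack `p` onto the stack `q`, or just empty it if the state does not satisfy `c`. -/
def moveIf (c : E → Bool) (p q : Port Γ) : Program Γ (Regs E) :=
  .single <| popBit p (fun v o => (o, v.2)) <|
    .branch (fun v => v.1.isSome)
      (.branch (fun v => c v.2.2)
        (pushBit q (fun v => v.1.getD false) (.goto fun _ => ())) (.goto fun _ => ()))
      .halt

theorem runs_moveIf (c : E → Bool) {p q : Port Γ} (hpq : p.k ≠ q.k) (e : E) (r' : Option Bool)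
    (x : List Bool) (S : ∀ k, List (Γ k)) (hx : bits S p = x) (r : Option Bool) :
    (moveIf c p q).Runs (r, r', e) S (none, r', e)
      (put (put S p []) q (if c e then x.reverse ++ bits S q else bits S q)) (x.length + 1) := by
  induction x generalizing S r with
  | nil =>
    have hS : put (put S p []) q (if c e then [].reverse ++ bits S q else bits S q) = S := by
      simp [put_eq_self hx]
    rw [hS]
    exact (Program.runs_single_halt (by simp [hx, put_eq_self hx])).mono (by simp)
  | cons b x ih =>
    cases hc : c e
    · exact Program.runs_single_loop (S' := put S p x) (by simp [hx, hc])
        (ih (put S p x) (by simp) (some b)) (by simp [hc, bits_put_of_ne S hpq.symm])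
    · exact Program.runs_single_loop (S' := put (put S p x) q (b :: bits S q))
        (by simp [hx, hc, bits_put_of_ne S hpq.symm])
        (ih (put (put S p x) q (b :: bits S q)) (by simp [bits_put_of_ne _ hpq]) (some b))
        (by simp [hc, put_comm _ hpq.symm])

/-- Empty the stack `p`; `q` is any other stack. -/
def drain (p q : Port Γ) : Program Γ (Regs E) :=
  moveIf (fun _ => false) p q

theorem runs_drain {p q : Port Γ} (hpq : p.k ≠ q.k) (e : E) (r r' : Option Bool)
    (S : ∀ k, List (Γ k)) :
    (drain p q).Runs (r, r', e) S (none, r', e) (put S p []) ((bits S p).length + 1) := by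
  have h := runs_moveIf (fun _ => false) hpq e r' _ S rfl r
  have hS : put (put S p []) q (bits S q) = put S p [] :=
    put_eq_self (bits_put_of_ne S hpq.symm _)
  simp only [Bool.false_eq_true, if_false, hS] at h
  exact h

/-- Read the code of a string from the stack `p` and push its bits onto the stack `q`. -/
def parse (p q : Port Γ) : Program Γ (Regs E) :=
  .single <| popBit p (fun v o => (o, v.2)) <|
    .branch (fun v => v.1.getD false)
      (popBit p (fun v o => (o, v.2)) <|
        pushBit q (fun v => v.1.getD false) <| .goto fun _ => ())
      (.load (fun v => (none, v.2)) .halt)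

theorem runs_parse {p q : Port Γ} (hpq : p.k ≠ q.k) (e : E) (r' : Option Bool)
    (x rest : List Bool) (S : ∀ k, List (Γ k)) (hx : bits S p = encodeStr x ++ rest)
    (r : Option Bool) :
    (parse p q).Runs (r, r', e) S (none, r', e)
      (put (put S p rest) q (x.reverse ++ bits S q)) (x.length + 1) := by
  induction x generalizing S r with
  | nil =>
    refine (Program.runs_single_halt ?_).mono (by simp)
    simp only [encodeStr, List.cons_append, List.nil_append] at hx
    have h : put (put S p rest) q (bits S q) = put S p rest :=
      put_eq_self (by simp [bits_put_of_ne S hpq.symm])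
    simp [hx, h]
  | cons b x ih =>
    simp only [encodeStr, List.cons_append] at hx
    exact Program.runs_single_loop
      (S' := put (put S p (encodeStr x ++ rest)) q (b :: bits S q))
      (by simp [hx, bits_put_of_ne S hpq.symm])
      (ih (put (put S p (encodeStr x ++ rest)) q (b :: bits S q))
        (by simp [bits_put_of_ne _ hpq]) (some b)) (by simp [put_comm _ hpq.symm])

/-- An exhausted stack is read as the empty string. This covers tuples with fewer than three
entries, on which the machine must also halt in time. -/
theorem runs_parse_headD {p q : Port Γ} (hpq : p.k ≠ q.k) (e : E) (r' : Option Bool)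
    (zs : List Str) (S : ∀ k, List (Γ k)) (hS : bits S p = encodeTuple zs) (r : Option Bool) :
    (parse p q).Runs (r, r', e) S (none, r', e)
      (put (put S p (encodeTuple zs.tail)) q ((zs.headD []).reverse ++ bits S q))
      ((zs.headD []).length + 1) := by
  cases zs with
  | nil =>
    have h : put (put S p (encodeTuple [].tail)) q (([].headD []).reverse ++ bits S q) = S := by
      simp [put_eq_self hS]
    rw [h]
    exact Program.runs_single_halt
      (by simp [show bits S p = [] from hS, put_eq_self (show bits S p = [] from hS)])
  | cons z zs =>
    exact runs_parse hpq e r' z (encodeTuple zs) S (by rw [hS]; simp [encodeTuple]) r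

theorem encodeStr_eq_flatMap (w : Str) :
    encodeStr w = (w.flatMap fun b => [true, b]) ++ [false] := by
  induction w with
  | nil => rfl
  | cons b w ih => simp [encodeStr, ih]

/-- Empty the stack `x` onto the stack `t`, and push each bit, preceded by `true`, onto the
stack `i`. -/
def copyMarked (x t i : Port Γ) : Program Γ (Regs E) :=
  .single <| popBit x (fun v o => (o, v.2)) <|
    .branch (fun v => v.1.isSome)
      (pushBit t (fun v => v.1.getD false) <| pushBit i (fun v => v.1.getD false) <|
        pushBit i (fun _ => true) <| .goto fun _ => ())
      .halt

theorem runs_copyMarked {x t i : Port Γ} (hxt : x.k ≠ t.k) (hxi : x.k ≠ i.k) (hti : t.k ≠ i.k)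
    (e : E) (r' : Option Bool) (w : List Bool) (S : ∀ k, List (Γ k)) (hw : bits S x = w)
    (r : Option Bool) :
    (copyMarked x t i).Runs (r, r', e) S (none, r', e)
      (put (put (put S x []) t (w.reverse ++ bits S t)) i
        ((w.reverse.flatMap fun b => [true, b]) ++ bits S i)) (w.length + 1) := by
  induction w generalizing S r with
  | nil =>
    have hS : put (put (put S x []) t ([].reverse ++ bits S t)) i
        (([].reverse.flatMap fun b => [true, b]) ++ bits S i) = S := by
      simp [put_eq_self hw]
    rw [hS]
    exact (Program.runs_single_halt (by simp [hw, put_eq_self hw])).mono (by simp)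
  | cons b w ih =>
    exact Program.runs_single_loop
      (S' := put (put (put S x w) t (b :: bits S t)) i (true :: b :: bits S i))
      (by simp [hw, bits_put_of_ne _ hxt.symm, bits_put_of_ne _ hxi.symm, bits_put_of_ne _ hti.symm])
      (ih _ (by simp [bits_put_of_ne _ hxt, bits_put_of_ne _ hxi]) (some b))
      (by simp [bits_put_of_ne _ hti, put_comm _ hxt.symm, put_comm _ hxi.symm,
        put_comm _ hti.symm])

/-- Empty the stack `x`, which holds a string in reverse, onto the stack `t`, and push the code
of the string onto the stack `i`. -/
def build (x t i : Port Γ) : Program Γ (Regs E) :=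
  (emit i fun _ => false).seq (copyMarked x t i)

theorem runs_build {x t i : Port Γ} (hxt : x.k ≠ t.k) (hxi : x.k ≠ i.k) (hti : t.k ≠ i.k) (e : E)
    (r r' : Option Bool) (w : List Bool) (S : ∀ k, List (Γ k)) (hw : bits S x = w.reverse) :
    (build x t i).Runs (r, r', e) S (none, r', e)
      (put (put (put S x []) t (w ++ bits S t)) i (encodeStr w ++ bits S i)) (w.length + 2) := by
  have h := (runs_emit i (fun _ => false) e r r' S).seq (runs_copyMarked hxt hxi hti e r' w.reverse
    (put S i (false :: bits S i)) (by simp [bits_put_of_ne _ hxi, hw]) r)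
  have hS : put (put (put (put S i (false :: bits S i)) x []) t (w.reverse.reverse ++
      bits (put S i (false :: bits S i)) t)) i ((w.reverse.reverse.flatMap fun b => [true, b]) ++
        bits (put S i (false :: bits S i)) i) =
      put (put (put S x []) t (w ++ bits S t)) i (encodeStr w ++ bits S i) := by
    simp [put_comm _ hxi.symm, put_comm _ hti.symm, encodeStr_eq_flatMap, bits_put_of_ne _ hti]
  rw [hS] at h
  exact h.mono (by simp; omega)

/-- Read two stacks in parallel; update the state, and copy the two strings in reverse. -/
def scan (p q p' q' : Port Γ) (up : Option Bool → Option Bool → E → E) : Program Γ (Regs E) :=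
  .single <| popBit p (fun v o => (o, v.2)) <| popBit q (fun v o => (v.1, o, v.2.2)) <|
    .branch (fun v => v.1.isSome || v.2.1.isSome)
      (.load (fun v => (v.1, v.2.1, up v.1 v.2.1 v.2.2)) <|
        .branch (fun v => v.1.isSome)
          (pushBit p' (fun v => v.1.getD false) <| .branch (fun v => v.2.1.isSome)
            (pushBit q' (fun v => v.2.1.getD false) <| .goto fun _ => ()) (.goto fun _ => ()))
          (pushBit q' (fun v => v.2.1.getD false) <| .goto fun _ => ()))
      .halt

/-- The state reached by `scan`. -/
def scanState (up : Option Bool → Option Bool → E → E) : List Bool → List Bool → E → E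
  | [], [], e => e
  | a :: x, [], e => scanState up x [] (up (some a) none e)
  | [], b :: y, e => scanState up [] y (up none (some b) e)
  | a :: x, b :: y, e => scanState up x y (up (some a) (some b) e)
termination_by x y => x.length + y.length

theorem runs_scan {p q p' q' : Port Γ} (h₁ : p.k ≠ q.k) (h₂ : p.k ≠ p'.k) (h₃ : p.k ≠ q'.k)
    (h₄ : q.k ≠ p'.k) (h₅ : q.k ≠ q'.k) (h₆ : p'.k ≠ q'.k)
    (up : Option Bool → Option Bool → E → E) (x y : List Bool) (e : E) (S : ∀ k, List (Γ k))
    (hx : bits S p = x) (hy : bits S q = y) (r r' : Option Bool) :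
    (scan p q p' q' up).Runs (r, r', e) S (none, none, scanState up x y e)
      (put (put (put (put S p []) q []) p' (x.reverse ++ bits S p')) q' (y.reverse ++ bits S q'))
      (x.length + y.length + 1) := by
  have hnil : ∀ S : ∀ k, List (Γ k), bits S p = [] → bits S q = [] →
      put (put S p []) q [] = S := fun S hp hq => by rw [put_eq_self hp, put_eq_self hq]
  have hb := fun (S : ∀ k, List (Γ k)) (L : List Bool) => And.intro (bits_put_of_ne S h₁ L) <|
    And.intro (bits_put_of_ne S h₂ L) <| And.intro (bits_put_of_ne S h₃ L) <|
    And.intro (bits_put_of_ne S h₄ L) <| And.intro (bits_put_of_ne S h₅ L) (bits_put_of_ne S h₆ L)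
  have hb' := fun (S : ∀ k, List (Γ k)) (L : List Bool) =>
    And.intro (bits_put_of_ne S h₁.symm L) <|
    And.intro (bits_put_of_ne S h₂.symm L) <| And.intro (bits_put_of_ne S h₃.symm L) <|
    And.intro (bits_put_of_ne S h₄.symm L) <| And.intro (bits_put_of_ne S h₅.symm L)
      (bits_put_of_ne S h₆.symm L)
  have hc := fun (S : ∀ k, List (Γ k)) (L L' : List Bool) =>
    And.intro (put_comm S h₁.symm L L') <|
    And.intro (put_comm S h₂.symm L L') <| And.intro (put_comm S h₃.symm L L') <|
    And.intro (put_comm S h₄.symm L L') <| And.intro (put_comm S h₅.symm L L')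
      (put_comm S h₆.symm L L')
  induction x, y, e using scanState.induct (up := up) generalizing S r r' with
  | case1 e =>
    have hS : put (put (put (put S p []) q []) p' ([].reverse ++ bits S p')) q'
        ([].reverse ++ bits S q') = S := by
      simp [hnil S hx hy]
    rw [hS, scanState]
    exact (Program.runs_single_halt (by simp [hx, hy, hb', hnil])).mono (by simp)
  | case2 a x e ih =>
    rw [scanState]
    refine (Program.runs_single_loop (S' := put (put (put S p x) q []) p' (a :: bits S p'))
      (by simp [hx, hy, hb']) (ih _ (by simp [hb]) (by simp [hb]) (some a) none)
      ?_).mono (by simp)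
    simp [hb', hc]
  | case3 b y e ih =>
    rw [scanState]
    refine (Program.runs_single_loop (S' := put (put (put S p []) q y) q' (b :: bits S q'))
      (by simp [hx, hy, hb']) (ih _ (by simp [hb]) (by simp [hb]) none (some b))
      ?_).mono (by simp)
    simp [hb, hb', hc]
  | case4 a x b y e ih =>
    rw [scanState]
    refine (Program.runs_single_loop
      (S' := put (put (put (put S p x) q y) p' (a :: bits S p')) q' (b :: bits S q'))
      (by simp [hx, hy, hb']) (ih _ (by simp [hb]) (by simp [hb]) (some a) (some b))
      ?_).mono (by simp; omega)
    simp [hb, hc]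

/-- Read the codes of the strings left on the stack `p`, and push a bit on the stack `q` for each
of them. -/
def count (p q : Port Γ) : Program Γ (Regs E) :=
  .single <| popBit p (fun v o => (o, v.2)) <|
    .branch (fun v => v.1.isSome)
      (.branch (fun v => v.1.getD false)
        (popBit p (fun v o => (o, v.2)) <| .goto fun _ => ())
        (pushBit q (fun _ => true) <| .goto fun _ => ()))
      .halt

theorem runs_count {p q : Port Γ} (hpq : p.k ≠ q.k) (e : E) (r' : Option Bool)
    (zs : List Str) (S : ∀ k, List (Γ k)) (hS : bits S p = encodeTuple zs) (r : Option Bool) :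
    (count p q).Runs (r, r', e) S (none, r', e)
      (put (put S p []) q (List.replicate zs.length true ++ bits S q))
      ((encodeTuple zs).length + 1) := by
  induction zs generalizing S r with
  | nil =>
    have h₀ : bits S p = [] := hS
    have hS' : put (put S p []) q (List.replicate 0 true ++ bits S q) = S := by
      simp [put_eq_self h₀]
    rw [List.length_nil, hS']
    exact (Program.runs_single_halt (by simp [h₀, put_eq_self h₀])).mono
      (by simp)
  | cons z zs ih =>
    have hcons : encodeTuple (z :: zs) = encodeStr z ++ encodeTuple zs := by
      simp [encodeTuple]
    rw [hcons] at hS ⊢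
    clear hcons
    -- Each bit of the string is skipped together with its marker; only the terminating `false`
    -- pushes a bit.
    induction z generalizing S r with
    | nil =>
      exact (Program.runs_single_loop (S' := put (put S p (encodeTuple zs)) q (true :: bits S q))
        (by simp [hS, encodeStr, bits_put_of_ne _ hpq.symm])
        (ih _ (by simp [bits_put_of_ne _ hpq]) (some false))
        (by simp [put_comm _ hpq.symm, List.replicate_succ'])).mono (by simp [encodeStr])
    | cons b z ihz =>
      exact (Program.runs_single_loop (S' := put S p (encodeStr z ++ encodeTuple zs))
        (by simp [hS, encodeStr])
        (ihz _ (by simp) (some b)) (by simp [bits_put_of_ne _ hpq.symm])).mono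
        (by simp [encodeStr])

end Ports

/-- A program that computes `f` within polynomial time yields a bundled machine. -/
theorem polyTime_of_program {α : Type} (enc : α → List Bool) (f : α → Str) {K : Type}
    [DecidableEq K] [Fintype K] {Γ : K → Type} {σ : Type} [Fintype σ] (P : Program Γ σ)
    (i o : Port Γ) (v : σ) (p : Polynomial ℕ)
    (H : ∀ a, P.Runs v (put (fun _ => []) i (enc a)) v (put (fun _ => []) o (f a))
      (p.eval (enc a).length)) :
    Nonempty (Turing.TM2ComputableInPolyTime enc (id : Str → List Bool) f) :=
  let tm : FinTM2 :=
    { K := K, k₀ := i.k, k₁ := o.k, Γ := Γ, Λ := P.Λ, main := P.main, σ := σ, initialState := v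
      Γk₀Fin := Fintype.ofEquiv Bool i.e.symm, m := P.code }
  ⟨{tm := tm, inputAlphabet := i.e, outputAlphabet := o.e, time := p
    outputsFun := fun a => ((outputsInTime_iff tm _ _ _).2 (H a)).some }⟩

/-- The machine of a polynomial-time computable function, as a program. -/
theorem exists_program_of_polyTime {α : Type} {enc : α → List Bool} {f : α → Str}
    (h : Nonempty (Turing.TM2ComputableInPolyTime enc (id : Str → List Bool) f)) :
    ∃ (K : Type) (_ : DecidableEq K) (_ : Fintype K) (Γ : K → Type) (σ : Type) (_ : Fintype σ)
      (P : Program Γ σ) (i o : Port Γ) (v : σ) (p : Polynomial ℕ),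
      ∀ a, P.Runs v (put (fun _ => []) i (enc a)) v (put (fun _ => []) o (f a))
        (p.eval (enc a).length) := by
  obtain ⟨c⟩ := h
  exact ⟨c.tm.K, c.tm.kDecidableEq, c.tm.kFin, c.tm.Γ, c.tm.σ, c.tm.σFin, programOf c.tm,
    ⟨_, c.inputAlphabet⟩, ⟨_, c.outputAlphabet⟩, c.tm.initialState, c.time,
    fun a => (outputsInTime_iff c.tm _ _ _).1 ⟨c.outputsFun a⟩⟩

/-! ### Calling a machine for a function of two strings -/

section Ask

variable {K K₁ : Type} [DecidableEq K] [DecidableEq K₁] {Γ : K → Type} {E σ₁ : Type}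

/-- A stack of a machine as a stack of a larger machine. -/
def Port.lift (i : K₁ → K) (p : Port fun k => Γ (i k)) : Port Γ := ⟨i p.k, p.e⟩

theorem put_lift {i : K₁ → K} (hi : i.Injective) {S : ∀ k, List (Γ k)} (hS : ∀ k, S (i k) = [])
    (p : Port fun k => Γ (i k)) (L : List Bool) (k : K₁) :
    put S (p.lift i) L (i k) = put (fun _ => []) p L k := by
  rcases eq_or_ne k p.k with rfl | h
  · simp only [put, Port.lift, Function.update_self]; rfl
  · rw [put_apply_of_ne _ h, put_apply_of_ne _ (hi.ne h), hS]

/-- The stacks `x` and `y` hold two strings in reverse. Call the program `P` on the pair, compare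
its output with the first string, and restore all stacks. -/
def ask (i : K₁ → K) (get : E → σ₁) (set : σ₁ → E → E) (P : Program (fun k => Γ (i k)) σ₁)
    (inp out : Port fun k => Γ (i k)) (x y t d : Port Γ) (up : Option Bool → Option Bool → E → E) :
    Program Γ (Regs E) :=
  (((((build y t (inp.lift i)).seq (moveIf (fun _ => true) t y)).seq
    (build x t (inp.lift i))).seq
    (P.lift i (fun v => get v.2.2) fun a v => (v.1, v.2.1, set a v.2.2))).seq
    (scan t (out.lift i) x d up)).seq (drain d t)

/-- The code of the pair is built back to front, hence `Y` before `X`. The copy of `X` left on `t`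
is compared with the output, and this very pass writes `X` back in reverse. Since all stacks and the
state of the called machine are restored, the call can be repeated. -/
theorem runs_ask {i : K₁ → K} (hi : i.Injective) {get : E → σ₁} {set : σ₁ → E → E}
    (hgs : ∀ a e, get (set a e) = a) (hss : ∀ a b e, set a (set b e) = set a e)
    (hsg : ∀ e, set (get e) e = e) {P : Program (fun k => Γ (i k)) σ₁}
    {inp out : Port fun k => Γ (i k)} {x y t d : Port Γ} (hxt : x.k ≠ t.k)
    (hxd : x.k ≠ d.k) (hyt : y.k ≠ t.k) (htd : t.k ≠ d.k) (hxi : ∀ k, x.k ≠ i k)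
    (hyi : ∀ k, y.k ≠ i k) (hti : ∀ k, t.k ≠ i k) (hdi : ∀ k, d.k ≠ i k)
    (up : Option Bool → Option Bool → E → E) {v : σ₁} {X Y F : Str} {τ : ℕ}
    (hP : P.Runs v (put (fun _ => []) inp (encodeTuple [X, Y])) v (put (fun _ => []) out F) τ)
    {S : ∀ k, List (Γ k)} (hX : bits S x = X.reverse) (hY : bits S y = Y.reverse)
    (ht : bits S t = []) (hd : bits S d = []) (hS : ∀ k, S (i k) = []) {e : E} (he : get e = v)
    (r r' : Option Bool) :
    (ask i get set P inp out x y t d up).Runs (r, r', e) S (none, none, scanState up X F e) S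
      (2 * X.length + 2 * Y.length + 2 * F.length + τ + 7) := by
  have hbi : ∀ p : Port fun k => Γ (i k), bits S (p.lift i) = [] := fun p => by
    simp only [bits, Port.lift, hS, List.map_nil]
  have hxl : ∀ p : Port fun k => Γ (i k), x.k ≠ (p.lift i).k := fun p => hxi p.k
  have hyl : ∀ p : Port fun k => Γ (i k), y.k ≠ (p.lift i).k := fun p => hyi p.k
  have htl : ∀ p : Port fun k => Γ (i k), t.k ≠ (p.lift i).k := fun p => hti p.k
  have hdl : ∀ p : Port fun k => Γ (i k), d.k ≠ (p.lift i).k := fun p => hdi p.k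
  have h₁ := runs_build hyt (hyl inp) (htl inp) e r r' Y S hY
  have h₂ := runs_moveIf (fun _ : E => true) hyt.symm e r' Y _
    (by simp [bits_put_of_ne _ (htl inp), ht] :
      bits (put (put (put S y []) t (Y ++ bits S t)) (inp.lift i)
        (encodeStr Y ++ bits S (inp.lift i))) t = Y) none
  rw [show put (put (put (put (put S y []) t (Y ++ bits S t)) (inp.lift i)
      (encodeStr Y ++ bits S (inp.lift i))) t []) y (if true then Y.reverse ++ bits (put (put
        (put S y []) t (Y ++ bits S t)) (inp.lift i) (encodeStr Y ++ bits S (inp.lift i))) y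
          else bits (put (put (put S y []) t (Y ++ bits S t)) (inp.lift i)
            (encodeStr Y ++ bits S (inp.lift i))) y) = put S (inp.lift i) (encodeStr Y) by
    simp only [hbi, ht, if_true, List.append_nil, bits_put_of_ne _ (hyl inp), bits_put_of_ne _ hyt,
      bits_put, put_comm _ (htl inp).symm, put_comm _ (hyl inp).symm, put_comm _ hyt.symm,
      put_put]
    rw [put_eq_self hY, put_eq_self ht]] at h₂
  have h₃ := runs_build hxt (hxl inp) (htl inp) e none r' X (put S (inp.lift i) (encodeStr Y))
    (by rw [bits_put_of_ne _ (hxl inp), hX])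
  rw [show put (put (put (put S (inp.lift i) (encodeStr Y)) x []) t
      (X ++ bits (put S (inp.lift i) (encodeStr Y)) t)) (inp.lift i)
      (encodeStr X ++ bits (put S (inp.lift i) (encodeStr Y)) (inp.lift i)) =
      put (put (put S x []) t X) (inp.lift i) (encodeTuple [X, Y]) by
    simp [bits_put_of_ne _ (htl inp), ht, put_comm _ (htl inp).symm, put_comm _ (hxl inp).symm,
      encodeTuple]] at h₃
  have hS' : ∀ k, put (put S x []) t X (i k) = [] := fun k => by
    rw [put_apply_of_ne _ (hti k).symm, put_apply_of_ne _ (hxi k).symm, hS]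
  have h₄ := hP.lift (i := i) hi (get := fun v : Regs E => get v.2.2)
    (set := fun a v => (v.1, v.2.1, set a v.2.2)) (fun a v => hgs a _)
    (fun a b v => by rw [hss]) (none, r', e) (put_lift hi hS' inp (encodeTuple [X, Y]))
    (put_lift hi hS' out F) (fun k hk => by
      rw [put_apply_of_ne (p := out.lift i) _ fun h => hk ⟨_, h.symm⟩,
        put_apply_of_ne (p := inp.lift i) _ fun h => hk ⟨_, h.symm⟩])
  have h₅ := runs_scan (htl out) hxt.symm htd (hxl out).symm (hdl out).symm hxd up X F e
    (put (put (put S x []) t X) (out.lift i) F) (by simp [bits_put_of_ne _ (htl out)]) (by simp)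
    none r'
  rw [show put (put (put (put (put (put (put S x []) t X) (out.lift i) F) t []) (out.lift i) [])
      x (X.reverse ++ bits (put (put (put S x []) t X) (out.lift i) F) x)) d
      (F.reverse ++ bits (put (put (put S x []) t X) (out.lift i) F) d) = put S d F.reverse by
    simp only [bits_put_of_ne _ (hxl out), bits_put_of_ne _ (hdl out), bits_put_of_ne _ hxt,
      bits_put_of_ne _ htd.symm, bits_put_of_ne _ hxd.symm, bits_put, hd, List.append_nil,
      put_comm _ (htl out).symm, put_comm _ (hxl out).symm, put_comm _ hxt.symm, put_put]
    rw [put_eq_self hX, put_eq_self ht, put_eq_self (hbi out)]] at h₅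
  have h₆ := runs_drain htd.symm (scanState up X F e) none none (put S d F.reverse)
  rw [put_put, put_eq_self hd, bits_put] at h₆
  -- The called machine starts and ends in the state `v`, which `e` already stores.
  have hse : set v e = e := by rw [← he, hsg]
  simp only [hse] at h₄
  refine (((((h₁.seq h₂).seq h₃).seq h₄).seq h₅).seq h₆).mono ?_
  simp
  omega

end Ask

/-! ### Three queries to each of two functions -/

theorem length_encodeStr (x : Str) : (encodeStr x).length = 2 * x.length + 1 := by
  induction x with
  | nil => rfl
  | cons b x ih => simp only [encodeStr, List.length_cons, ih]; omega

theorem length_getD_le (zs : List Str) (n : ℕ) :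
    (zs.getD n []).length ≤ (encodeTuple zs).length := by
  induction zs generalizing n with
  | nil => simp
  | cons z zs ih =>
    have h : (encodeTuple (z :: zs)).length = 2 * z.length + 1 + (encodeTuple zs).length := by
      simp [encodeTuple, length_encodeStr]
    cases n with
    | zero => simp only [List.getD_cons_zero]; omega
    | succ n => have := ih n; simp only [List.getD_cons_succ]; omega

theorem length_encodeTuple_drop_le (zs : List Str) (n : ℕ) :
    (encodeTuple (zs.drop n)).length ≤ (encodeTuple zs).length := by
  have h : encodeTuple zs = encodeTuple (zs.take n) ++ encodeTuple (zs.drop n) := by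
    rw [encodeTuple, encodeTuple, encodeTuple, ← List.flatMap_append, List.take_append_drop]
  rw [h, List.length_append]
  exact Nat.le_add_left _ _

theorem eval_mono_nat (p : Polynomial ℕ) : Monotone fun n : ℕ => p.eval n := by
  intro m n h
  simp only [Polynomial.eval_eq_sum, Polynomial.sum]
  exact Finset.sum_le_sum fun i _ => Nat.mul_le_mul_left _ (Nat.pow_le_pow_left h i)

/-- Conjoin the bit `b` to the `j`-th bit. -/
def recordBit {J : Type} [DecidableEq J] (a : J → Bool) (j : J) (b : Bool) : J → Bool :=
  Function.update a j (a j && b)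

/-- Every register starts as `true` and receives one conjunct, so at the end the registers are the
six answers. -/
theorem recordBit_six (s t : Fin 3 → Bool) :
    recordBit (recordBit (recordBit (recordBit (recordBit (recordBit (fun _ => true)
      (false, 0) (s 0)) (false, 1) (s 1)) (false, 2) (s 2)) (true, 0) (t 0)) (true, 1) (t 1))
      (true, 2) (t 2) = fun j : Bool × Fin 3 => if j.1 then t j.2 else s j.2 := by
  funext ⟨b, m⟩
  cases b <;> fin_cases m <;> simp [recordBit]

/-- One step of the comparison of two strings, recorded in the bit `j` of the state. -/
def compareStep {J V : Type} [DecidableEq J] (j : J) (a b : Option Bool) (e : (J → Bool) × V) :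
    (J → Bool) × V :=
  (recordBit e.1 j (decide (a = b)), e.2)

/-- A string that ends early contributes `none`, which differs from every bit, so unequal lengths
are detected as well. -/
theorem scanState_compareStep {J V : Type} [DecidableEq J] (j : J) (x y : List Bool)
    (e : (J → Bool) × V) :
    scanState (compareStep j) x y e =
      (recordBit e.1 j (decide (x = y)), e.2) := by
  induction x, y, e using scanState.induct (up := compareStep j) with
  | case1 e => simp [scanState, recordBit]
  | case2 a x e ih => rw [scanState, ih]; simp [compareStep, recordBit]
  | case3 b y e ih => rw [scanState, ih]; simp [compareStep, recordBit]
  | case4 a x b y e ih =>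
    rw [scanState, ih]
    simp [compareStep, recordBit, Bool.and_assoc]

/-- The first element of the `c`-th pair from `{0, 1, 2}`. -/
def firstIdx : Fin 3 → ℕ := ![0, 0, 1]

/-- The second element of the `c`-th pair from `{0, 1, 2}`. -/
def secondIdx : Fin 3 → ℕ := ![1, 2, 2]

/-- Does `f` select the first element of the `c`-th pair among the first three strings? -/
def selectsFirst (f : Str × Str → Str) (zs : List Str) (c : Fin 3) : Bool :=
  decide (zs.getD (firstIdx c) [] = f (zs.getD (firstIdx c) [], zs.getD (secondIdx c) []))

section Ctrl

variable {K : Type} {Γ : K → Type}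

/-- The control stacks, which hold bits, next to the stacks of other machines. -/
def ctrl (n : Fin 7) : Port (Sum.elim (fun _ : Fin 7 => Bool) Γ) := ⟨.inl n, Equiv.refl Bool⟩

@[simp] theorem ctrl_k (n : Fin 7) :
    (ctrl n : Port (Sum.elim (fun _ : Fin 7 => Bool) Γ)).k = .inl n :=
  rfl

end Ctrl

/-- All computability needed for the upper bounds: six queries on the first three strings, a fixed
table `g` applied to the answers, and padding to the required length. -/
theorem polyTimeComputable_of_selectsFirst {fA fB : Str × Str → Str}
    (hA : PolyTimeComputable₂ fA) (hB : PolyTimeComputable₂ fB)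
    (hA' : ∀ x y, fA (x, y) = x ∨ fA (x, y) = y) (hB' : ∀ x y, fB (x, y) = x ∨ fB (x, y) = y)
    (g : (Fin 3 → Bool) → (Fin 3 → Bool) → Fin 3 → Bool) :
    PolyTimeComputable fun zs =>
      List.ofFn (g (selectsFirst fA zs) (selectsFirst fB zs)) ++
        List.replicate (zs.length - 3) true := by
  obtain ⟨KA, _, _, ΓA, σA, _, PA, iA, oA, vA, pA, hPA⟩ := exists_program_of_polyTime hA
  obtain ⟨KB, _, _, ΓB, σB, _, PB, iB, oB, vB, pB, hPB⟩ := exists_program_of_polyTime hB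
  let Γ : Fin 7 ⊕ (KA ⊕ KB) → Type := Sum.elim (fun _ => Bool) (Sum.elim ΓA ΓB)
  let E : Type := (Bool × Fin 3 → Bool) × σA × σB
  -- Stack 0 is the input, 1 to 3 hold the first three strings in reverse, 4 and 5 are scratch, and
  -- 6 is the output.
  let c : Fin 7 → Port Γ := ctrl
  let jA : KA → Fin 7 ⊕ (KA ⊕ KB) := fun k => .inr (.inl k)
  let jB : KB → Fin 7 ⊕ (KA ⊕ KB) := fun k => .inr (.inr k)
  have hjA : jA.Injective := fun a b h => Sum.inl_injective (Sum.inr_injective h)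
  have hjB : jB.Injective := fun a b h => Sum.inr_injective (Sum.inr_injective h)
  let xs : ℕ → Fin 7 := fun n => if n = 0 then 1 else if n = 1 then 2 else 3
  let qA : Fin 3 → Program Γ (Regs E) := fun n =>
    ask jA (fun e => e.2.1) (fun a e => (e.1, a, e.2.2)) PA iA oA (c (xs (firstIdx n)))
      (c (xs (secondIdx n))) (c 4) (c 5) (compareStep (false, n))
  let qB : Fin 3 → Program Γ (Regs E) := fun n =>
    ask jB (fun e => e.2.2) (fun a e => (e.1, e.2.1, a)) PB iB oB (c (xs (firstIdx n)))
      (c (xs (secondIdx n))) (c 4) (c 5) (compareStep (true, n))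
  let out : Fin 3 → Program Γ (Regs E) := fun n =>
    emit (c 6) fun e => g (fun m => e.1 (false, m)) (fun m => e.1 (true, m)) n
  let P : Program Γ (Regs E) :=
    ((parse (c 0) (c 1)).seq <| (parse (c 0) (c 2)).seq <| (parse (c 0) (c 3)).seq <|
      ((qA 0).seq <| (qA 1).seq <| (qA 2).seq <| (qB 0).seq <| (qB 1).seq (qB 2)).seq <|
      (drain (c 1) (c 4)).seq <| (drain (c 2) (c 4)).seq <| (drain (c 3) (c 4)).seq <|
      -- The output is pushed from its last bit to its first, and the registers are then reset
      -- because a machine has to halt in its initial state.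
      (count (c 0) (c 6)).seq <| (out 2).seq <| (out 1).seq <| (out 0).seq <|
      modify fun e => (fun _ => true, e.2))
  have hne : ∀ m n : Fin 7, m ≠ n → (c m).k ≠ (c n).k := fun m n h h' => h (Sum.inl_injective h')
  refine polyTime_of_program (Γ := Γ) (σ := Regs E) _ _ P (c 0) (c 6)
    (none, none, fun _ => true, vA, vB)
    -- Each string has length at most `n`, so the code of a queried pair has length at most `4n +
    -- 2`. The remaining work is linear, with generous constants.
    (60 * Polynomial.X + 100 + 3 * pA.comp (4 * Polynomial.X + 2) +
      3 * pB.comp (4 * Polynomial.X + 2)) fun zs => ?_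
  set n := (encodeTuple zs).length with hn
  set x : ℕ → Str := fun k => zs.getD k [] with hx
  have hxn : ∀ k, (x k).length ≤ n := fun k => length_getD_le zs k
  have hx0 : zs.headD [] = x 0 := by cases zs <;> rfl
  have hx1 : zs.tail.headD [] = x 1 := by rcases zs with _ | ⟨_, _ | ⟨_, _⟩⟩ <;> rfl
  have hx2 : zs.tail.tail.headD [] = x 2 := by
    rcases zs with _ | ⟨_, _ | ⟨_, _ | ⟨_, _⟩⟩⟩ <;> rfl
  have hd1 : zs.tail = zs.drop 1 := List.drop_one.symm
  have hd2 : zs.tail.tail = zs.drop 2 := by rcases zs with _ | ⟨_, _ | ⟨_, _⟩⟩ <;> rfl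
  have hd3 : zs.tail.tail.tail = zs.drop 3 := by
    rcases zs with _ | ⟨_, _ | ⟨_, _ | ⟨_, _⟩⟩⟩ <;> rfl
  have hb : ∀ (S : ∀ k, List (Γ k)) {i j : Fin 7} (_ : i ≠ j) (L : List Bool),
      bits (put S (c j) L) (c i) = bits S (c i) := fun S i j h L => bits_put_of_ne S (hne i j h) L
  set S₀ : ∀ k, List (Γ k) := fun _ => [] with hS₀
  have hb₀ : ∀ p : Port Γ, bits S₀ p = [] := fun p => rfl
  set S : ∀ k, List (Γ k) := put (put (put (put S₀ (c 0) (encodeTuple (zs.drop 3))) (c 1)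
    (x 0).reverse) (c 2) (x 1).reverse) (c 3) (x 2).reverse with hS
  have p₀ : ∀ e : E, (parse (c 0) (c 1)).Runs (none, none, e) (put S₀ (c 0) (encodeTuple zs))
      (none, none, e) (put (put S₀ (c 0) (encodeTuple (zs.drop 1))) (c 1) (x 0).reverse)
      (n + 1) := fun e => by
    have h := runs_parse_headD (hne 0 1 (by decide)) e none zs
      (put S₀ (c 0) (encodeTuple zs)) (bits_put _ _ _) none
    rw [put_put, hb _ (by decide), hb₀, List.append_nil, hx0, hd1] at h
    exact h.mono (Nat.add_le_add_right (hxn 0) 1)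
  have p₁ : ∀ e : E, (parse (c 0) (c 2)).Runs (none, none, e)
      (put (put S₀ (c 0) (encodeTuple (zs.drop 1))) (c 1) (x 0).reverse)
      (none, none, e) (put (put (put S₀ (c 0) (encodeTuple (zs.drop 2))) (c 1) (x 0).reverse)
        (c 2) (x 1).reverse) (n + 1) := fun e => by
    have h := runs_parse_headD (hne 0 2 (by decide)) e none zs.tail
      (put (put S₀ (c 0) (encodeTuple (zs.drop 1))) (c 1) (x 0).reverse)
      (by rw [hb _ (by decide), bits_put, hd1]) none
    rw [put_comm _ (hne 1 0 (by decide)), put_put, hb _ (by decide), hb _ (by decide), hb₀,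
      List.append_nil, hx1, hd2] at h
    exact h.mono (Nat.add_le_add_right (hxn 1) 1)
  have p₂ : ∀ e : E, (parse (c 0) (c 3)).Runs (none, none, e)
      (put (put (put S₀ (c 0) (encodeTuple (zs.drop 2))) (c 1) (x 0).reverse)
        (c 2) (x 1).reverse) (none, none, e) S (n + 1) := fun e => by
    have h := runs_parse_headD (hne 0 3 (by decide)) e none zs.tail.tail
      (put (put (put S₀ (c 0) (encodeTuple (zs.drop 2))) (c 1) (x 0).reverse)
        (c 2) (x 1).reverse)
      (by rw [hb _ (by decide), hb _ (by decide), bits_put, hd2]) none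
    rw [put_comm _ (hne 2 0 (by decide)), put_comm _ (hne 1 0 (by decide)), put_put,
      hb _ (by decide), hb _ (by decide), hb _ (by decide), hb₀,
      List.append_nil, hx2, hd3] at h
    exact h.mono (Nat.add_le_add_right (hxn 2) 1)
  have hSx : ∀ k ≤ 2, bits S (c (xs k)) = (x k).reverse := by
    intro k hk
    interval_cases k
    · simp only [xs, hS, if_true]
      rw [hb _ (by decide), hb _ (by decide), bits_put]
    · simp only [xs, hS, if_true, one_ne_zero, if_false]
      rw [hb _ (by decide), bits_put]
    · simp only [xs, hS, OfNat.ofNat_ne_zero, OfNat.ofNat_ne_one, if_false]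
      rw [bits_put]
  have hS4 : bits S (c 4) = [] := by
    rw [hS, hb _ (by decide), hb _ (by decide), hb _ (by decide), hb _ (by decide), hb₀]
  have hS5 : bits S (c 5) = [] := by
    rw [hS, hb _ (by decide), hb _ (by decide), hb _ (by decide), hb _ (by decide), hb₀]
  have hSr : ∀ k, S (.inr k) = [] := fun k => by
    rw [hS, put_apply_of_ne _ (by simp [c]), put_apply_of_ne _ (by simp [c]),
      put_apply_of_ne _ (by simp [c]), put_apply_of_ne _ (by simp [c])]
  have hidx : ∀ m : Fin 3, firstIdx m ≤ 2 ∧ secondIdx m ≤ 2 ∧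
      xs (firstIdx m) ≠ xs (secondIdx m) ∧ xs (firstIdx m) ≠ 4 ∧ xs (firstIdx m) ≠ 5 ∧
      xs (secondIdx m) ≠ 4 := by decide
  have hlen : ∀ m : Fin 3, (encodeTuple [x (firstIdx m), x (secondIdx m)]).length ≤ 4 * n + 2 := by
    intro m
    have h₁ := hxn (firstIdx m)
    have h₂ := hxn (secondIdx m)
    simp only [encodeTuple, List.flatMap_cons, List.flatMap_nil, List.append_nil,
      List.length_append, length_encodeStr]
    omega
  -- The answer to a query is one of its arguments, hence short enough to be read and erased in
  -- linear time.
  have hSel : ∀ (f : Str × Str → Str) (_ : ∀ x y, f (x, y) = x ∨ f (x, y) = y) (m : Fin 3),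
      (f (x (firstIdx m), x (secondIdx m))).length ≤ n := by
    intro f hf m
    rcases hf (x (firstIdx m)) (x (secondIdx m)) with h | h <;> rw [h] <;> exact hxn _
  have runA : ∀ (m : Fin 3) (a : Bool × Fin 3 → Bool), (qA m).Runs (none, none, a, vA, vB) S
      (none, none, recordBit a (false, m) (selectsFirst fA zs m), vA, vB) S
      (6 * n + pA.eval (4 * n + 2) + 7) := by
    intro m a
    obtain ⟨h₁, h₂, h₃, h₄, h₅, h₆⟩ := hidx m
    have h := runs_ask hjA (E := E) (get := fun e => e.2.1) (set := fun a e => (e.1, a, e.2.2))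
      (fun _ _ => rfl) (fun _ _ _ => rfl) (fun _ => rfl) (hne _ _ h₄) (hne _ _ h₅)
      (hne _ _ h₆) (hne 4 5 (by decide)) (fun _ => Sum.inl_ne_inr) (fun _ => Sum.inl_ne_inr)
      (fun _ => Sum.inl_ne_inr) (fun _ => Sum.inl_ne_inr) (compareStep (false, m))
      (hPA (x (firstIdx m), x (secondIdx m))) (hSx _ h₁) (hSx _ h₂) hS4 hS5 (fun k => hSr _)
      (e := (a, vA, vB)) rfl none none
    rw [scanState_compareStep] at h
    refine h.mono ?_
    have := hxn (firstIdx m)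
    have := hxn (secondIdx m)
    have := hSel fA hA' m
    have := eval_mono_nat pA (hlen m)
    simp only at this ⊢
    omega
  have runB : ∀ (m : Fin 3) (a : Bool × Fin 3 → Bool), (qB m).Runs (none, none, a, vA, vB) S
      (none, none, recordBit a (true, m) (selectsFirst fB zs m), vA, vB) S
      (6 * n + pB.eval (4 * n + 2) + 7) := by
    intro m a
    obtain ⟨h₁, h₂, h₃, h₄, h₅, h₆⟩ := hidx m
    have h := runs_ask hjB (E := E) (get := fun e => e.2.2) (set := fun a e => (e.1, e.2.1, a))
      (fun _ _ => rfl) (fun _ _ _ => rfl) (fun _ => rfl) (hne _ _ h₄) (hne _ _ h₅)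
      (hne _ _ h₆) (hne 4 5 (by decide)) (fun _ => Sum.inl_ne_inr) (fun _ => Sum.inl_ne_inr)
      (fun _ => Sum.inl_ne_inr) (fun _ => Sum.inl_ne_inr) (compareStep (true, m))
      (hPB (x (firstIdx m), x (secondIdx m))) (hSx _ h₁) (hSx _ h₂) hS4 hS5 (fun k => hSr _)
      (e := (a, vA, vB)) rfl none none
    rw [scanState_compareStep] at h
    refine h.mono ?_
    have := hxn (firstIdx m)
    have := hxn (secondIdx m)
    have := hSel fB hB' m
    have := eval_mono_nat pB (hlen m)
    simp only at this ⊢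
    omega
  have drain₁ : ∀ e : E, (drain (c 1) (c 4)).Runs (none, none, e) S (none, none, e)
      (put (put (put S₀ (c 0) (encodeTuple (zs.drop 3))) (c 2) (x 1).reverse) (c 3) (x 2).reverse)
      (n + 1) := fun e => by
    have h := runs_drain (hne 1 4 (by decide)) e none none S
    rw [show bits S (c 1) = (x 0).reverse from hSx 0 (by decide), hS, put_comm _ (hne 3 1 (by decide)), put_comm _ (hne 2 1 (by decide)),
      put_put, put_eq_self (by rw [hb _ (by decide), hb₀] :
        bits (put S₀ (c 0) (encodeTuple (zs.drop 3))) (c 1) = [])] at h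
    exact h.mono (by simpa using hxn 0)
  have drain₂ : ∀ e : E, (drain (c 2) (c 4)).Runs (none, none, e)
      (put (put (put S₀ (c 0) (encodeTuple (zs.drop 3))) (c 2) (x 1).reverse) (c 3) (x 2).reverse)
      (none, none, e) (put (put S₀ (c 0) (encodeTuple (zs.drop 3))) (c 3) (x 2).reverse)
      (n + 1) := fun e => by
    have h := runs_drain (hne 2 4 (by decide)) e none none
      (put (put (put S₀ (c 0) (encodeTuple (zs.drop 3))) (c 2) (x 1).reverse) (c 3) (x 2).reverse)
    rw [hb _ (by decide), bits_put, put_comm _ (hne 3 2 (by decide)),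
      put_put, put_eq_self (by rw [hb _ (by decide), hb₀] :
        bits (put S₀ (c 0) (encodeTuple (zs.drop 3))) (c 2) = [])] at h
    exact h.mono (by simpa using hxn 1)
  have drain₃ : ∀ e : E, (drain (c 3) (c 4)).Runs (none, none, e)
      (put (put S₀ (c 0) (encodeTuple (zs.drop 3))) (c 3) (x 2).reverse)
      (none, none, e) (put S₀ (c 0) (encodeTuple (zs.drop 3))) (n + 1) := fun e => by
    have h := runs_drain (hne 3 4 (by decide)) e none none
      (put (put S₀ (c 0) (encodeTuple (zs.drop 3))) (c 3) (x 2).reverse)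
    rw [bits_put, put_put, put_eq_self (by rw [hb _ (by decide), hb₀] :
        bits (put S₀ (c 0) (encodeTuple (zs.drop 3))) (c 3) = [])] at h
    exact h.mono (by simpa using hxn 2)
  have runCount : ∀ e : E, (count (c 0) (c 6)).Runs (none, none, e)
      (put S₀ (c 0) (encodeTuple (zs.drop 3))) (none, none, e)
      (put S₀ (c 6) (List.replicate (zs.length - 3) true)) (n + 1) := fun e => by
    have h := runs_count (hne 0 6 (by decide)) e none (zs.drop 3)
      (put S₀ (c 0) (encodeTuple (zs.drop 3))) (bits_put _ _ _) none
    rw [put_put, hb _ (by decide), hb₀, List.append_nil, List.length_drop,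
      put_eq_self (hb₀ (c 0))] at h
    exact h.mono (Nat.add_le_add_right (length_encodeTuple_drop_le zs 3) 1)
  have runOut : ∀ (m : Fin 3) (L : List Bool) (e : E), (out m).Runs (none, none, e)
      (put S₀ (c 6) L) (none, none, e)
      (put S₀ (c 6) (g (fun m => e.1 (false, m)) (fun m => e.1 (true, m)) m :: L)) 1 := by
    intro m L e
    have h := runs_emit (c 6) (fun e : E => g (fun m => e.1 (false, m)) (fun m => e.1 (true, m)) m)
      e none none (put S₀ (c 6) L)
    rwa [put_put, bits_put] at h
  have runAsk := (runA 0 fun _ => true).seq <| (runA 1 _).seq <| (runA 2 _).seq <|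
    (runB 0 _).seq <| (runB 1 _).seq (runB 2 _)
  rw [recordBit_six] at runAsk
  have run := (p₀ (fun _ => true, vA, vB)).seq <| (p₁ _).seq <| (p₂ _).seq <| runAsk.seq <|
    (drain₁ _).seq <| (drain₂ _).seq <| (drain₃ _).seq <| (runCount _).seq <|
    (runOut 2 _ _).seq <| (runOut 1 _ _).seq <| (runOut 0 _ _).seq <|
    runs_modify (fun e : E => (fun _ => true, e.2)) _ _ _ _
  refine run.mono ?_
  simp only [Polynomial.eval_add, Polynomial.eval_mul, Polynomial.eval_comp, Polynomial.eval_X,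
    Polynomial.eval_ofNat]
  omega

/-! ### Intersections and unions of P-selective sets are in P-mc(3) -/

/-- `r` lists, for the pairs `(0,1)`, `(0,2)`, `(1,2)`, whether the first element beats the second.
Does `i` lose against both other elements? -/
def isLoser (r : Fin 3 → Bool) : Fin 3 → Bool :=
  ![!r 0 && !r 1, r 0 && !r 2, r 1 && r 2]

/-- An element that is neither the loser of `r` nor that of `s`. -/
def nonLoser (r s : Fin 3 → Bool) : Fin 3 :=
  if !isLoser r 0 && !isLoser s 0 then 0 else if !isLoser r 1 && !isLoser s 1 then 1 else 2

/-- Pigeonhole: two players cannot both lose the game between them, so each tournament has at most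
one loser, and two tournaments exclude at most two of three players. -/
theorem isLoser_nonLoser (r s : Fin 3 → Bool) :
    isLoser r (nonLoser r s) = false ∧ isLoser s (nonLoser r s) = false := by
  revert r s
  decide

/-- When exactly one argument lies in `A`, the selector is forced to return it, so the only
non-member loses both games. -/
theorem isLoser_selectsFirst {f : Str × Str → Str} {A : Set Str} (hf : IsSelector f A)
    {zs : List Str} {i : Fin 3} (hi : zs.getD i [] ∉ A)
    (h : ∀ j : Fin 3, j ≠ i → zs.getD j [] ∈ A) : isLoser (selectsFirst f zs) i = true := by
  have hl : ∀ x y, x ∉ A → y ∈ A → decide (x = f (x, y)) = false := fun x y hx hy =>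
    decide_eq_false fun h => hx (h ▸ (hf x y).2 (.inr hy))
  have hr : ∀ x y, x ∈ A → y ∉ A → f (x, y) = x := fun x y hx hy =>
    (hf x y).1.resolve_right fun h => hy (h ▸ (hf x y).2 (.inl hx))
  have h₀ := h 0
  have h₁ := h 1
  have h₂ := h 2
  fin_cases i <;>
    simp_all [isLoser, selectsFirst, firstIdx, secondIdx]

/-- Dually, the only member wins both games, and negating the answers exchanges winning and losing.
-/
theorem isLoser_not_selectsFirst {f : Str × Str → Str} {A : Set Str} (hf : IsSelector f A)
    {zs : List Str} {i : Fin 3} (hi : zs.getD i [] ∈ A)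
    (h : ∀ j : Fin 3, j ≠ i → zs.getD j [] ∉ A) :
    isLoser (fun c => !selectsFirst f zs c) i = true := by
  have hl : ∀ x y, x ∉ A → y ∈ A → decide (x = f (x, y)) = false := fun x y hx hy =>
    decide_eq_false fun h => hx (h ▸ (hf x y).2 (.inr hy))
  have hr : ∀ x y, x ∈ A → y ∉ A → f (x, y) = x := fun x y hx hy =>
    (hf x y).1.resolve_right fun h => hy (h ▸ (hf x y).2 (.inl hx))
  have h₀ := h 0
  have h₁ := h 1
  have h₂ := h 2
  fin_cases i <;>
    simp_all [isLoser, selectsFirst, firstIdx, secondIdx]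

/-- If the characteristic string starts with the three given bits, they are the values of the
characteristic function at the first three strings. -/
theorem mem_iff_of_charString_eq {A : Set Str} {zs : List Str} {b : Fin 3 → Bool} {u : List Bool}
    (hzs : 3 ≤ zs.length) (h : charString A zs = List.ofFn b ++ u) (i : Fin 3) :
    zs.getD i [] ∈ A ↔ b i = true := by
  obtain ⟨x, y, z, zs, rfl⟩ : ∃ x y z zs', zs = x :: y :: z :: zs' := by
    rcases zs with _ | ⟨x, _ | ⟨y, _ | ⟨z, zs⟩⟩⟩
    · simp at hzs
    · simp at hzs
    · simp at hzs
    · exact ⟨x, y, z, zs, rfl⟩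
  simp only [charString, List.map_cons, List.ofFn_succ, List.ofFn_zero, List.cons_append,
    List.cons.injEq] at h
  obtain ⟨h₀, h₁, h₂, -⟩ := h
  fin_cases i
  · change _ ↔ b 0 = true
    rw [← h₀]; simp
  · change _ ↔ b 1 = true
    rw [show b 1 = _ from h₁.symm]; simp
  · change _ ↔ b 2 = true
    rw [show b 2 = _ from h₂.symm]; simp

theorem interClass_subset : interClass PSel PSel ⊆ PMcConst 3 := by
  rintro _ ⟨A, ⟨f, hf, hfA⟩, B, ⟨g, hg, hgB⟩, rfl⟩
  -- The excluded pattern is 0 at the chosen non-loser and 1 at the other two positions. Bits after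
  -- the third do not matter.
  refine ⟨_, polyTimeComputable_of_selectsFirst hf hg (fun x y => (hfA x y).1)
    (fun x y => (hgB x y).1) fun r s i => decide (i ≠ nonLoser r s), fun zs hzs => ⟨?_, fun h => ?_⟩⟩
  · simp only [List.length_append, List.length_ofFn, List.length_replicate]
    have : 3 ≤ zs.length := hzs
    omega
  · have hmem := mem_iff_of_charString_eq hzs h
    obtain ⟨h₁, h₂⟩ := isLoser_nonLoser (selectsFirst f zs) (selectsFirst g zs)
    set i := nonLoser (selectsFirst f zs) (selectsFirst g zs)
    have hj : ∀ j : Fin 3, j ≠ i → zs.getD j [] ∈ A ∩ B := fun j hj =>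
      (hmem j).2 (decide_eq_true hj)
    have hi : ¬ zs.getD i [] ∈ A ∩ B := fun hi => absurd ((hmem i).1 hi) (by simp)
    by_cases hA : zs.getD i [] ∈ A
    · rw [isLoser_selectsFirst hgB (fun hB => hi ⟨hA, hB⟩) fun j h => (hj j h).2] at h₂
      cases h₂
    · rw [isLoser_selectsFirst hfA hA fun j h => (hj j h).1] at h₁
      cases h₁

theorem unionClass_subset : unionClass PSel PSel ⊆ PMcConst 3 := by
  rintro _ ⟨A, ⟨f, hf, hfA⟩, B, ⟨g, hg, hgB⟩, rfl⟩
  refine ⟨_, polyTimeComputable_of_selectsFirst hf hg (fun x y => (hfA x y).1)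
    (fun x y => (hgB x y).1)
    fun r s i => decide (i = nonLoser (fun c => !r c) fun c => !s c),
    fun zs hzs => ⟨?_, fun h => ?_⟩⟩
  · simp only [List.length_append, List.length_ofFn, List.length_replicate]
    have : 3 ≤ zs.length := hzs
    omega
  · have hmem := mem_iff_of_charString_eq hzs h
    obtain ⟨h₁, h₂⟩ := isLoser_nonLoser (fun c => !selectsFirst f zs c)
      fun c => !selectsFirst g zs c
    set i := nonLoser (fun c => !selectsFirst f zs c) fun c => !selectsFirst g zs c
    have hj : ∀ j : Fin 3, j ≠ i → ¬ zs.getD j [] ∈ A ∪ B := fun j hj h =>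
      hj (of_decide_eq_true ((hmem j).1 h))
    rcases (hmem i).2 (by simp) with hA | hB
    · rw [isLoser_not_selectsFirst hfA hA fun j h h' => hj j h (.inl h')] at h₁
      cases h₁
    · rw [isLoser_not_selectsFirst hgB hB fun j h h' => hj j h (.inr h')] at h₂
      cases h₂

/-! ### Selectors given by finite automata -/

/-- A single parallel pass with finitely many states takes linear time. It leaves both strings in
reverse, and moving the chosen one to the output restores its order. -/
theorem polyTimeComputable₂_of_scanState {E : Type} [Fintype E]
    (up : Option Bool → Option Bool → E → E) (e₀ : E) (acc : E → Bool) :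
    PolyTimeComputable₂ fun p => if acc (scanState up p.1 p.2 e₀) then p.1 else p.2 := by
  let Γ : Fin 6 → Type := fun _ => Bool
  let c : Fin 6 → Port Γ := fun n => ⟨n, Equiv.refl Bool⟩
  let P : Program Γ (Regs E) :=
    (parse (c 0) (c 1)).seq <| (parse (c 0) (c 2)).seq <|
    (moveIf (fun _ => true) (c 1) (c 3)).seq <| (moveIf (fun _ => true) (c 2) (c 4)).seq <|
    (scan (c 3) (c 4) (c 1) (c 2) up).seq <| (moveIf acc (c 1) (c 5)).seq <|
    (moveIf (fun e => !acc e) (c 2) (c 5)).seq <| modify fun _ => e₀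
  have hne : ∀ m n : Fin 6, m ≠ n → (c m).k ≠ (c n).k := fun _ _ h => h
  refine polyTime_of_program (Γ := Γ) (σ := Regs E) _ _ P (c 0) (c 5) (none, none, e₀)
    (10 * Polynomial.X + 10) ?_
  rintro ⟨x, y⟩
  set S₀ : ∀ k, List (Γ k) := fun _ => [] with hS₀
  have hb : ∀ (S : ∀ k, List (Γ k)) {i j : Fin 6} (_ : i ≠ j) (L : List Bool),
      bits (put S (c j) L) (c i) = bits S (c i) := fun S i j h L => bits_put_of_ne S (hne i j h) L
  have hb₀ : ∀ p : Port Γ, bits S₀ p = [] := fun p => rfl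
  have hp₀ : ∀ p : Port Γ, put S₀ p [] = S₀ := fun p => put_eq_self (hb₀ p)
  have h₁ := runs_parse (hne 0 1 (by decide)) e₀ none x (encodeStr y)
    (put S₀ (c 0) (encodeTuple [x, y])) (by simp [encodeTuple]) none
  rw [put_put, hb _ (by decide), hb₀, List.append_nil] at h₁
  have h₂ := runs_parse (hne 0 2 (by decide)) e₀ none y []
    (put (put S₀ (c 0) (encodeStr y)) (c 1) x.reverse)
    (by rw [hb _ (by decide), bits_put, List.append_nil]) none
  rw [put_comm _ (hne 1 0 (by decide)), put_put, hp₀, hb _ (by decide), hb _ (by decide), hb₀,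
    List.append_nil] at h₂
  have h₃ := runs_moveIf (fun _ => true) (hne 1 3 (by decide)) e₀ none x.reverse
    (put (put S₀ (c 1) x.reverse) (c 2) y.reverse) (by rw [hb _ (by decide), bits_put]) none
  rw [put_comm _ (hne 2 1 (by decide)), put_put, hp₀, hb _ (by decide), hb _ (by decide), hb₀,
    List.append_nil, if_pos rfl, List.reverse_reverse] at h₃
  have h₄ := runs_moveIf (fun _ => true) (hne 2 4 (by decide)) e₀ none y.reverse
    (put (put S₀ (c 2) y.reverse) (c 3) x) (by rw [hb _ (by decide), bits_put]) none
  rw [put_comm _ (hne 3 2 (by decide)), put_put, hp₀, hb _ (by decide), hb _ (by decide), hb₀,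
    List.append_nil, if_pos rfl, List.reverse_reverse] at h₄
  have h₅ := runs_scan (hne 3 4 (by decide)) (hne 3 1 (by decide)) (hne 3 2 (by decide))
    (hne 4 1 (by decide)) (hne 4 2 (by decide)) (hne 1 2 (by decide)) up x y e₀
    (put (put S₀ (c 3) x) (c 4) y) (by rw [hb _ (by decide), bits_put]) (by rw [bits_put])
    none none
  rw [put_comm _ (hne 4 3 (by decide)), put_put, put_put, hp₀, hp₀, hb _ (by decide),
    hb _ (by decide), hb₀, hb _ (by decide), hb _ (by decide), hb₀, List.append_nil,
    List.append_nil] at h₅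
  set e := scanState up x y e₀ with he
  have h₆ := runs_moveIf acc (hne 1 5 (by decide)) e none x.reverse
    (put (put S₀ (c 1) x.reverse) (c 2) y.reverse) (by rw [hb _ (by decide), bits_put]) none
  rw [put_comm _ (hne 2 1 (by decide)), put_put, hp₀, hb _ (by decide), hb _ (by decide), hb₀,
    List.append_nil, List.reverse_reverse] at h₆
  have h₇ := runs_moveIf (fun e => !acc e) (hne 2 5 (by decide)) e none y.reverse
    (put (put S₀ (c 2) y.reverse) (c 5) (if acc e then x else []))
    (by rw [hb _ (by decide), bits_put]) none
  rw [put_comm _ (hne 5 2 (by decide)), put_put, put_put, hp₀, bits_put,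
    List.reverse_reverse] at h₇
  -- The two conditional moves have complementary conditions, so exactly one of them writes to the
  -- output stack.
  have hout : (if (!acc e) = true then y ++ (if acc e = true then x else [])
      else (if acc e = true then x else [])) = if acc e = true then x else y := by
    cases acc e <;> simp
  rw [hout] at h₇
  have h₈ := runs_modify (fun _ => e₀) e none none
    (put S₀ (c 5) (if acc e = true then x else y))
  refine (h₁.seq <| h₂.seq <| h₃.seq <| h₄.seq <| h₅.seq <| h₆.seq <| h₇.seq h₈).mono ?_
  simp [encodeTuple, length_encodeStr]
  omega

/-! ### Lexicographic cuts -/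

theorem toLex_lt_iff (f g : ℕ → Bool) :
    toLex f < toLex g ↔
      f 0 < g 0 ∨ f 0 = g 0 ∧ toLex (fun i => f (i + 1)) < toLex (fun i => g (i + 1)) := by
  constructor
  · rintro ⟨i, hi, h⟩
    cases i with
    | zero => exact .inl h
    | succ i =>
      exact .inr ⟨hi 0 (Nat.succ_pos i), i, fun j hj => hi (j + 1) (Nat.succ_lt_succ hj), h⟩
  · rintro (h | ⟨h₀, i, hi, h⟩)
    · exact ⟨0, fun j hj => absurd hj (Nat.not_lt_zero j), h⟩
    · refine ⟨i + 1, fun j hj => ?_, h⟩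
      cases j with
      | zero => exact h₀
      | succ j => exact hi j (Nat.lt_of_succ_lt_succ hj)

theorem toLex_lt_iff_shift (n : ℕ) {f g : ℕ → Bool} (h : ∀ j < n, f j = g j) :
    toLex f < toLex g ↔ toLex (fun i => f (i + n)) < toLex (fun i => g (i + n)) := by
  induction n with
  | zero => rfl
  | succ n ih =>
    rw [ih fun j hj => h j (hj.trans (Nat.lt_succ_self n)), toLex_lt_iff, Nat.zero_add,
      h n (Nat.lt_succ_self n)]
    simp only [lt_irrefl, false_or, true_and, Nat.add_right_comm, ← Nat.add_assoc]

theorem not_true_lt (g : ℕ → Bool) : ¬ toLex (fun _ : ℕ => true) < toLex g := by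
  rintro ⟨i, -, h⟩
  exact absurd h (not_lt_of_ge (Bool.le_true _))

/-- Keep the terms of one parity and replace the others by `true`. -/
def mask (p : Bool) (s : ℕ → Bool) (i : ℕ) : Bool := if i.bodd = p then s i else true

/-- The terms of one parity of a string, which is continued by the bit `true`. -/
def key (p : Bool) (w : Str) : Lex (ℕ → Bool) := toLex (mask p fun i => w.getD i true)

theorem mask_succ (p : Bool) (s : ℕ → Bool) (i : ℕ) :
    mask p s (i + 1) = mask (!p) (fun i => s (i + 1)) i := by
  simp only [mask, Nat.bodd_succ]
  cases i.bodd <;> cases p <;> rfl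

/-- The strings whose terms of parity `p` form a sequence below the one of `R`. -/
def cut (p : Bool) (R : ℕ → Bool) : Set Str := {w | key p w < toLex (mask p R)}

/-- One step of the comparison of two keys; the state holds the parity and the result. -/
def keyStep (a b : Option Bool) (e : Bool × Ordering) : Bool × Ordering :=
  (!e.1, e.2.then <| if e.1 then .eq else compare (a.getD true) (b.getD true))

/-- Position 0 is even, so the heads count only for `p = false`; dropping them flips the parity.
This is the recursion that `keyStep` carries out. -/
theorem key_lt_key_iff (p : Bool) (x y : Str) :
    key p x < key p y ↔
      (p = false ∧ x.headD true < y.headD true) ∨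
        (p = false → x.headD true = y.headD true) ∧ key (!p) x.tail < key (!p) y.tail := by
  have ht : ∀ w : Str, (fun i => mask p (fun i => w.getD i true) (i + 1)) =
      mask (!p) fun i => w.tail.getD i true := fun w => by
    funext i
    rw [mask_succ]
    cases w <;> simp
  have h0 : ∀ w : Str, mask p (fun i => w.getD i true) 0 = if p = false then w.headD true else true :=
    fun w => by cases w <;> cases p <;> rfl
  simp only [key]
  rw [toLex_lt_iff, ht, ht, h0, h0]
  cases p <;> simp

/-- The induction needs an arbitrary state: a decided ordering is kept, and an undecided one defers
to the keys of what remains. -/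
theorem scanState_keyStep (x y : List Bool) (e : Bool × Ordering) :
    (scanState keyStep x y e).2 = .lt ↔ e.2 = .lt ∨ e.2 = .eq ∧ key e.1 x < key e.1 y := by
  have hcmp : ∀ (a b p : Bool) (o : Ordering), (o.then (if p then .eq else compare a b) = .lt ↔
      o = .lt ∨ o = .eq ∧ p = false ∧ a < b) ∧
      (o.then (if p then .eq else compare a b) = .eq ↔ o = .eq ∧ (p = false → a = b)) := by
    decide
  have step : ∀ (x y : Str) (e : Bool × Ordering),
      (e.2 = .lt ∨ e.2 = .eq ∧ key e.1 x < key e.1 y) ↔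
      ((keyStep x.head? y.head? e).2 = .lt ∨ (keyStep x.head? y.head? e).2 = .eq ∧
        key (keyStep x.head? y.head? e).1 x.tail < key (keyStep x.head? y.head? e).1 y.tail) := by
    rintro x y ⟨p, o⟩
    have hd : ∀ w : Str, w.head?.getD true = w.headD true := fun w => by cases w <;> rfl
    simp only [keyStep, hd, (hcmp _ _ _ _).1, (hcmp _ _ _ _).2, key_lt_key_iff p x y]
    tauto
  induction x, y, e using scanState.induct (up := keyStep) with
  | case1 e =>
    rw [scanState]
    exact ⟨.inl, fun h => h.elim id fun h => (lt_irrefl _ h.2).elim⟩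
  | case2 a x e ih => rw [scanState]; exact ih.trans (step (a :: x) [] e).symm
  | case3 b y e ih => rw [scanState]; exact ih.trans (step [] (b :: y) e).symm
  | case4 a x b y e ih => rw [scanState]; exact ih.trans (step (a :: x) (b :: y) e).symm

/-- A cut is downward closed in the linear order of keys, so the argument with the smaller key is a
safe choice. For equal keys membership agrees, and either argument will do. -/
theorem cut_mem_PSel (p : Bool) (R : ℕ → Bool) : cut p R ∈ PSel := by
  refine ⟨_, polyTimeComputable₂_of_scanState keyStep (p, .eq) fun e => decide (e.2 = .lt),
    fun x y => ?_⟩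
  have hlt : decide ((scanState keyStep x y (p, .eq)).2 = .lt) = true ↔ key p x < key p y := by
    rw [decide_eq_true_iff, scanState_keyStep]
    simp
  dsimp only
  by_cases h : key p x < key p y
  · rw [if_pos (hlt.2 h)]
    exact ⟨.inl rfl, fun h' => h'.elim id fun hy => lt_trans h hy⟩
  · rw [if_neg (mt hlt.1 h)]
    exact ⟨.inr rfl, fun h' => h'.elim (fun hx => lt_of_le_of_lt (not_lt.1 h) hx) id⟩

/-- A block of four bits, as the beginning of a sequence. -/
theorem append_mem_cut_iff (p : Bool) (R : ℕ → Bool) (u : Str) (a b c d : Bool)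
    (hu : u.length.bodd = false) (h : ∀ i < u.length, u.getD i true = R i) :
    u ++ [a, b, c, d] ∈ cut p R ↔
      if p then b < R (u.length + 1) ∨ b = R (u.length + 1) ∧ d < R (u.length + 3)
      else a < R u.length ∨ a = R u.length ∧ c < R (u.length + 2) := by
  have hmask : ∀ s : ℕ → Bool, (fun i => mask p s (i + u.length)) =
      mask p fun i => s (i + u.length) := fun s => by
    funext i
    simp [mask, Nat.bodd_add, hu]
  have hget : (fun i => (u ++ [a, b, c, d]).getD (i + u.length) true) =
      fun i => [a, b, c, d].getD i true := by
    funext i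
    rw [List.getD_append_right _ _ _ _ (Nat.le_add_left _ _), Nat.add_sub_cancel]
  -- After the block the key is constantly `true`, hence maximal. A tie within the block therefore
  -- means non-membership, whatever `R` does later.
  have htail : (fun i => mask p (fun i => [a, b, c, d].getD i true) (i + 1 + 1 + 1 + 1)) =
      fun _ => true := by
    funext i
    simp [mask]
  change toLex (mask p fun i => (u ++ [a, b, c, d]).getD i true) < toLex (mask p R) ↔ _
  rw [toLex_lt_iff_shift u.length, hmask, hmask, hget, toLex_lt_iff, toLex_lt_iff, toLex_lt_iff,
    toLex_lt_iff]
  · simp only [htail, not_true_lt, and_false, or_false]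
    cases p <;> simp [mask, Nat.add_comm]
  · intro j hj
    simp only [mask]
    rw [List.getD_append _ _ _ _ hj, h j hj]

/-! ### Diagonalisation -/

/-- Four bits. -/
abbrev Block : Type := Bool × Bool × Bool × Bool

/-- A block as a string. -/
def Block.toStr (w : Block) : Str := [w.1, w.2.1, w.2.2.1, w.2.2.2]

/-- Is the part of parity `p` of `w` below that of `r`? -/
def Block.below (p : Bool) (w r : Block) : Bool :=
  if p then decide (w.2.1 < r.2.1 ∨ w.2.1 = r.2.1 ∧ w.2.2.2 < r.2.2.2)
  else decide (w.1 < r.1 ∨ w.1 = r.1 ∧ w.2.2.1 < r.2.2.1)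

/-- Three blocks; they are increasing with respect to the first parity, while the second block
comes first with respect to the other one. -/
def probes : List Block :=
  [(false, false, false, true), (false, false, true, false), (true, true, false, false)]

open Classical in
-- Stage `n` asks `F n` about the probes appended to the part of `R` built so far. The next block of
-- `R` alone decides their membership in both cuts, so by `hop` it can be chosen to make the answer
-- of `F n` the true pattern.
theorem exists_diagonal_sequence (F : ℕ → List Str → Str) (op : Bool → Bool → Bool) (k : ℕ)
    (hk : k ≤ 3)
    (hop : ∀ t : List Bool, t.length = k → ∃ r : Block,
      (probes.take k).map (fun w => op (w.below false r) (w.below true r)) = t) :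
    ∃ R : ℕ → Bool, ∀ n, ∃ zs : List Str, zs.length = k ∧ ((F n zs).length = k →
      zs.map (fun z => op (decide (z ∈ cut false R)) (decide (z ∈ cut true R))) = F n zs) := by
  have hB : ∀ (n : ℕ) (u : Str), ∃ r : Block,
      (F n ((probes.take k).map fun w => u ++ w.toStr)).length = k →
        (probes.take k).map (fun w => op (w.below false r) (w.below true r)) =
          F n ((probes.take k).map fun w => u ++ w.toStr) := by
    intro n u
    by_cases h : (F n ((probes.take k).map fun w => u ++ w.toStr)).length = k
    · obtain ⟨r, hr⟩ := hop _ h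
      exact ⟨r, fun _ => hr⟩
    -- An answer of the wrong length needs no refutation; any block serves.
    · exact ⟨(true, true, true, true), fun h' => absurd h' h⟩
  choose B hB using hB
  let P : ℕ → Str := fun n => n.rec [] fun n u => u ++ (B n u).toStr
  have hPs : ∀ n, P (n + 1) = P n ++ (B n (P n)).toStr := fun n => rfl
  have hPl : ∀ n, (P n).length = 4 * n := fun n => by
    induction n with
    | zero => rfl
    | succ n ih => rw [hPs, List.length_append, ih]; rfl
  have hPm : ∀ m n i, m ≤ n → i < 4 * m → (P n).getD i true = (P m).getD i true := by
    intro m n i hmn hi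
    induction n, hmn using Nat.le_induction with
    | base => rfl
    | succ n hmn ih => rw [hPs, List.getD_append _ _ _ _ (by rw [hPl]; omega), ih]
  -- The prefix `P (i + 1)` has length `4 * (i + 1)`, so its position `i` is already final.
  let R : ℕ → Bool := fun i => (P (i + 1)).getD i true
  have hPR : ∀ n i, i < 4 * n → (P n).getD i true = R i := fun n i hi => by
    rcases le_total n (i + 1) with h | h
    · exact (hPm n (i + 1) i h hi).symm
    · exact hPm (i + 1) n i h (by omega)
  have hR : ∀ n i, i < 4 → R ((P n).length + i) = (B n (P n)).toStr.getD i true := fun n i hi => by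
    rw [← hPR (n + 1) _ (by rw [hPl]; omega), hPs,
      List.getD_append_right _ _ _ _ (Nat.le_add_right _ _), Nat.add_sub_cancel_left]
  have hcut : ∀ n p (w : Block), decide (P n ++ w.toStr ∈ cut p R) = w.below p (B n (P n)) := by
    rintro n p ⟨a, b, c, d⟩
    have h₀ := hR n 0 (by decide)
    have h₁ := hR n 1 (by decide)
    have h₂ := hR n 2 (by decide)
    have h₃ := hR n 3 (by decide)
    rw [Nat.add_zero] at h₀
    simp only [Block.toStr, append_mem_cut_iff p R (P n) a b c d (by simp [hPl])
      fun i hi => hPR n i (hPl n ▸ hi), h₀, h₁, h₂, h₃]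
    cases p <;> simp [Block.below]
  refine ⟨R, fun n => ⟨(probes.take k).map fun w => P n ++ w.toStr, ?_, fun h => ?_⟩⟩
  · simpa [probes] using hk
  · rw [← hB n (P n) h, List.map_map]
    simp only [Function.comp_def, hcut]

open Classical in
-- A comparing function for the diagonal set would occur in the enumeration as some `F n`, yet stage
-- `n` makes it output the actual characteristic string.
theorem not_subset_PMcConst (hc : {f : List Str → Str | PolyTimeComputable f}.Countable)
    {𝒞 : Set (Set Str)} (op : Bool → Bool → Bool)
    (h𝒞 : ∀ A ∈ PSel, ∀ B ∈ PSel,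
      {w | op (decide (w ∈ A)) (decide (w ∈ B)) = true} ∈ 𝒞) (k : ℕ) (hk : k ≤ 3)
    (hop : ∀ t : List Bool, t.length = k → ∃ r : Block,
      (probes.take k).map (fun w => op (w.below false r) (w.below true r)) = t) :
    ¬ 𝒞 ⊆ PMcConst k := by
  intro hsub
  obtain ⟨F, hF⟩ := Set.countable_iff_exists_subset_range.1 hc
  obtain ⟨R, hR⟩ := exists_diagonal_sequence F op k hk hop
  obtain ⟨f, hf, hfm⟩ := hsub (h𝒞 _ (cut_mem_PSel false R) _ (cut_mem_PSel true R))
  obtain ⟨n, rfl⟩ := hF hf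
  obtain ⟨zs, hzs, h⟩ := hR n
  obtain ⟨h₁, h₂⟩ := hfm zs hzs.ge
  refine h₂ ?_
  rw [← h (h₁.trans hzs), charString]
  simp

/-! ### There are countably many polynomial-time computable functions -/

theorem StepsTo.unique {α : Type*} {f : α → Option α} {m n : ℕ} {a b c : α}
    (hb : StepsTo f m a b) (hc : StepsTo f n a c) (hb' : f b = none) (hc' : f c = none) :
    b = c := by
  induction hb generalizing n with
  | refl a =>
    cases hc with
    | refl => rfl
    | head h _ => rw [hb'] at h; cases h
  | head h _ ih =>
    cases hc with
    | refl => rw [hc'] at h; cases h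
    | head h' hc =>
      rw [h] at h'
      cases h'
      exact ih hc hb'

/-! ### Countably many statements over finite data -/

section Countable

variable {K G Λ σ : Type}

/-- The nodes of a statement. -/
abbrev StmtToken (K G Λ σ : Type) : Type :=
  (K × (σ → G)) ⊕ (K × (σ → Option G → σ)) ⊕ (K × (σ → Option G → σ)) ⊕ (σ → σ) ⊕ (σ → Bool) ⊕
    (σ → Λ) ⊕ Unit

/-- The nodes of a statement in prefix order. -/
def stmtTokens : TM2.Stmt (fun _ : K => G) Λ σ → List (StmtToken K G Λ σ)
  | .push k f q => .inl (k, f) :: stmtTokens q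
  | .peek k f q => .inr (.inl (k, f)) :: stmtTokens q
  | .pop k f q => .inr (.inr (.inl (k, f))) :: stmtTokens q
  | .load f q => .inr (.inr (.inr (.inl f))) :: stmtTokens q
  | .branch f q₁ q₂ => .inr (.inr (.inr (.inr (.inl f)))) :: (stmtTokens q₁ ++ stmtTokens q₂)
  | .goto l => [.inr (.inr (.inr (.inr (.inr (.inl l)))))]
  | .halt => [.inr (.inr (.inr (.inr (.inr (.inr ())))))]

/-- Prefix notation is uniquely readable. The trailing lists are needed for `branch`, where the
second subtree follows the first. -/
theorem stmtTokens_append_inj (q q' : TM2.Stmt (fun _ : K => G) Λ σ)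
    {u u' : List (StmtToken K G Λ σ)} (h : stmtTokens q ++ u = stmtTokens q' ++ u') :
    q = q' ∧ u = u' := by
  induction q generalizing q' u u' with
  | branch f q₁ q₂ ih₁ ih₂ =>
    cases q' with
    | branch f' q₁' q₂' =>
      simp only [stmtTokens, List.cons_append, List.append_assoc, List.cons.injEq, Sum.inr.injEq,
        Sum.inl.injEq] at h
      obtain ⟨rfl, h⟩ := h
      obtain ⟨hq₁, h⟩ := ih₁ _ h
      obtain ⟨hq₂, hu⟩ := ih₂ _ h
      exact ⟨by rw [hq₁, hq₂], hu⟩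
    | _ => simp [stmtTokens] at h
  | goto l => cases q' <;> simp_all [stmtTokens]
  | halt => cases q' <;> simp_all [stmtTokens]
  | load f q ih =>
    cases q' with
    | load f' q' =>
      simp only [stmtTokens, List.cons_append, List.cons.injEq, Sum.inr.injEq,
        Sum.inl.injEq] at h
      obtain ⟨rfl, h⟩ := h
      obtain ⟨hq, hu⟩ := ih _ h
      exact ⟨by rw [hq], hu⟩
    | _ => simp [stmtTokens] at h
  | push k f q ih =>
    cases q' with
    | push k' f' q' =>
      simp only [stmtTokens, List.cons_append, List.cons.injEq, Sum.inl.injEq, Prod.mk.injEq] at h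
      obtain ⟨⟨rfl, rfl⟩, h⟩ := h
      obtain ⟨hq, hu⟩ := ih _ h
      exact ⟨by rw [hq], hu⟩
    | _ => simp [stmtTokens] at h
  | peek k f q ih =>
    cases q' with
    | peek k' f' q' =>
      simp only [stmtTokens, List.cons_append, List.cons.injEq, Sum.inr.injEq,
        Sum.inl.injEq, Prod.mk.injEq] at h
      obtain ⟨⟨rfl, rfl⟩, h⟩ := h
      obtain ⟨hq, hu⟩ := ih _ h
      exact ⟨by rw [hq], hu⟩
    | _ => simp [stmtTokens] at h
  | pop k f q ih =>
    cases q' with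
    | pop k' f' q' =>
      simp only [stmtTokens, List.cons_append, List.cons.injEq, Sum.inr.injEq,
        Sum.inl.injEq, Prod.mk.injEq] at h
      obtain ⟨⟨rfl, rfl⟩, h⟩ := h
      obtain ⟨hq, hu⟩ := ih _ h
      exact ⟨by rw [hq], hu⟩
    | _ => simp [stmtTokens] at h

theorem countable_stmt [Finite K] [Finite G] [Finite Λ] [Finite σ] :
    Countable (TM2.Stmt (fun _ : K => G) Λ σ) := by
  have : Function.Injective (stmtTokens (K := K) (G := G) (Λ := Λ) (σ := σ)) := fun q q' h =>
    (stmtTokens_append_inj q q' (u := []) (u' := []) (by rw [h])).1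
  exact this.countable

end Countable

/-- Machines whose stacks, symbols, labels and states are numbers. -/
abbrev NumMachine : Type :=
  Σ (k g l s : ℕ), (Fin l → TM2.Stmt (fun _ : Fin k => Fin g) (Fin l) (Fin s)) × Fin l × Fin s ×
    Fin k × Fin k × (Bool → Fin g) × (Bool → Fin g)

instance : Countable NumMachine := by
  have : ∀ k g l s : ℕ, Countable (TM2.Stmt (fun _ : Fin k => Fin g) (Fin l) (Fin s)) :=
    fun _ _ _ _ => countable_stmt
  infer_instance

/-- The machine halts on the input `a` with the output `b`. -/
def NumMachine.Computes : NumMachine → List Bool → List Bool → Prop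
  | ⟨_, _, _, _, m, l, v, i, o, ei, eo⟩, a, b =>
    eo.Injective ∧ ∃ n v' S',
      StepsTo (TM2.step m) n ⟨some l, v, Function.update (fun _ => []) i (a.map ei)⟩
        ⟨none, v', S'⟩ ∧ S' o = b.map eo

/-- Runs are deterministic, and injectivity of the output coding recovers the output from the stack.
-/
theorem NumMachine.Computes.unique {M : NumMachine} {a b b' : List Bool}
    (h : M.Computes a b) (h' : M.Computes a b') : b = b' := by
  obtain ⟨_, _, _, _, m, l, v, i, o, ei, eo⟩ := M
  obtain ⟨hinj, n, v₁, S₁, h, hb⟩ := h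
  obtain ⟨-, n', v₂, S₂, h', hb'⟩ := h'
  have := h.unique h' rfl rfl
  simp only [TM2.Cfg.mk.injEq, true_and] at this
  rw [this.2, hb'] at hb
  exact (List.map_injective_iff.2 hinj hb).symm

/-! ### Renaming a machine into a numerical one -/

section Translate

variable {K K' G Λ Λ' σ σ' : Type} {Γ : K → Type}

/-- The symbols that a statement can push. -/
def pushed : TM2.Stmt Γ Λ σ → Set (Sigma Γ)
  | .push k f q => Set.range (fun v => (⟨k, f v⟩ : Sigma Γ)) ∪ pushed q
  | .peek _ _ q => pushed q
  | .pop _ _ q => pushed q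
  | .load _ q => pushed q
  | .branch _ q₁ q₂ => pushed q₁ ∪ pushed q₂
  | .goto _ => ∅
  | .halt => ∅

theorem finite_pushed [Finite σ] (q : TM2.Stmt Γ Λ σ) : (pushed q).Finite := by
  induction q with
  | push k f q ih => exact (Set.finite_range _).union ih
  | branch p q₁ q₂ ih₁ ih₂ => exact ih₁.union ih₂
  | goto l => exact Set.finite_empty
  | halt => exact Set.finite_empty
  | _ => assumption

/-- Rename stacks, labels, states and symbols in a statement. -/
def translate (a : K → K') (b : Λ → Λ') (s : σ → σ') (s' : σ' → σ) (e : Sigma Γ → G)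
    (d : ∀ k, G → Option (Γ k)) : TM2.Stmt Γ Λ σ → TM2.Stmt (fun _ : K' => G) Λ' σ'
  | .push k f q => .push (a k) (fun v => e ⟨k, f (s' v)⟩) (translate a b s s' e d q)
  | .peek k f q => .peek (a k) (fun v o => s (f (s' v) (o.bind (d k)))) (translate a b s s' e d q)
  | .pop k f q => .pop (a k) (fun v o => s (f (s' v) (o.bind (d k)))) (translate a b s s' e d q)
  | .load f q => .load (fun v => s (f (s' v))) (translate a b s s' e d q)
  | .branch p q₁ q₂ =>
    .branch (fun v => p (s' v)) (translate a b s s' e d q₁) (translate a b s s' e d q₂)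
  | .goto l => .goto fun v => b (l (s' v))
  | .halt => .halt

/-- The stacks `S'` hold the renamed contents of the stacks `S`, all of which belong to `U`. -/
def StackRel (a : K → K') (e : Sigma Γ → G) (U : Set (Sigma Γ)) (S : ∀ k, List (Γ k))
    (S' : K' → List G) : Prop :=
  ∀ k, S' (a k) = (S k).map (fun γ => e ⟨k, γ⟩) ∧ ∀ γ ∈ S k, (⟨k, γ⟩ : Sigma Γ) ∈ U

variable {a : K → K'} {b : Λ → Λ'} {s : σ → σ'} {s' : σ' → σ} {e : Sigma Γ → G}
  {d : ∀ k, G → Option (Γ k)} {U : Set (Sigma Γ)}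

theorem StackRel.update [DecidableEq K] [DecidableEq K'] (ha : a.Injective) {S : ∀ k, List (Γ k)} {S' : K' → List G}
    (h : StackRel a e U S S') (k : K) {L : List (Γ k)} (hL : ∀ γ ∈ L, (⟨k, γ⟩ : Sigma Γ) ∈ U) :
    StackRel a e U (Function.update S k L)
      (Function.update S' (a k) (L.map fun γ => e ⟨k, γ⟩)) := by
  intro j
  rcases eq_or_ne j k with rfl | hj
  · simpa using hL
  · rw [Function.update_of_ne hj, Function.update_of_ne (ha.ne hj)]
    exact h j

theorem StackRel.head (hd : ∀ k γ, (⟨k, γ⟩ : Sigma Γ) ∈ U → d k (e ⟨k, γ⟩) = some γ)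
    {S : ∀ k, List (Γ k)} {S' : K' → List G} (h : StackRel a e U S S') (k : K) :
    (S' (a k)).head?.bind (d k) = (S k).head? := by
  obtain ⟨h₁, h₂⟩ := h k
  rw [h₁]
  cases hS : S k with
  | nil => rfl
  | cons γ L => exact hd k γ (h₂ γ (by simp [hS]))

/-- Decoding is only required to be correct on `U`. This suffices because the stacks contain only
symbols of `U` and statements push no others. -/
theorem stepAux_translate [DecidableEq K] [DecidableEq K'] (ha : a.Injective) (hs : ∀ v, s' (s v) = v)
    (hd : ∀ k γ, (⟨k, γ⟩ : Sigma Γ) ∈ U → d k (e ⟨k, γ⟩) = some γ)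
    (q : TM2.Stmt Γ Λ σ) (hq : pushed q ⊆ U) (v : σ) (S : ∀ k, List (Γ k)) (S' : K' → List G)
    (h : StackRel a e U S S') :
    ∃ T, TM2.stepAux (translate a b s s' e d q) (s v) S' =
        ⟨(TM2.stepAux q v S).l.map b, s (TM2.stepAux q v S).var, T⟩ ∧
      StackRel a e U (TM2.stepAux q v S).stk T := by
  induction q generalizing v S S' with
  | push k f q ih =>
    simp only [translate, TM2.stepAux, hs]
    refine ih (Set.subset_union_right.trans hq) v _ _ ?_
    rw [(h k).1]
    refine h.update ha k (L := f v :: S k) fun γ hγ => ?_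
    rcases List.mem_cons.1 hγ with rfl | hγ
    · exact hq (.inl ⟨v, rfl⟩)
    · exact (h k).2 γ hγ
  | peek k f q ih =>
    simp only [translate, TM2.stepAux, hs, h.head hd]
    exact ih hq _ _ _ h
  | pop k f q ih =>
    simp only [translate, TM2.stepAux, hs, h.head hd]
    refine ih hq _ _ _ ?_
    rw [(h k).1, ← List.map_tail]
    exact h.update ha k fun γ hγ => (h k).2 γ (List.mem_of_mem_tail hγ)
  | load f q ih =>
    simp only [translate, TM2.stepAux, hs]
    exact ih hq _ _ _ h
  | branch p q₁ q₂ ih₁ ih₂ =>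
    simp only [translate, TM2.stepAux, hs]
    cases p v
    · exact ih₂ (Set.subset_union_right.trans hq) _ _ _ h
    · exact ih₁ (Set.subset_union_left.trans hq) _ _ _ h
  | goto l =>
    simp only [translate, TM2.stepAux, hs]
    exact ⟨S', rfl, h⟩
  | halt =>
    simp only [translate, TM2.stepAux]
    exact ⟨S', rfl, h⟩

end Translate

/-- Finitely many symbols can be numbered. -/
theorem exists_numbering {K : Type} {Γ : K → Type} {U : Set (Sigma Γ)} (hU : U.Finite) :
    ∃ (g : ℕ) (e : Sigma Γ → Fin g) (d : ∀ k, Fin g → Option (Γ k)),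
      ∀ k γ, (⟨k, γ⟩ : Sigma Γ) ∈ U → d k (e ⟨k, γ⟩) = some γ := by
  classical
  have : Finite U := hU
  -- The extra element `none` is the common code of all symbols outside `U`.
  obtain ⟨g, ⟨q⟩⟩ := Finite.exists_equiv_fin (Option U)
  refine ⟨g, fun x => q (if h : x ∈ U then some ⟨x, h⟩ else none), fun k j =>
    (q.symm j).bind fun x => if h : x.1.1 = k then some (h ▸ x.1.2) else none, fun k γ h => ?_⟩
  simp [h]

/-- Stack alphabets may be infinite. However, finitely many statements and states push only finitely
many symbols, and with the input and output bits these are all that must be numbered. -/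
theorem exists_numMachine {f : List Str → Str} (hf : PolyTimeComputable f) :
    ∃ M : NumMachine, ∀ zs, M.Computes (encodeTuple zs) (f zs) := by
  obtain ⟨K, _, _, Γ, σ, _, P, i, o, v, p, hP⟩ := exists_program_of_polyTime hf
  obtain ⟨k, ⟨a⟩⟩ := Finite.exists_equiv_fin K
  obtain ⟨l, ⟨b⟩⟩ := Finite.exists_equiv_fin P.Λ
  obtain ⟨t, ⟨s⟩⟩ := Finite.exists_equiv_fin σ
  obtain ⟨g, e, d, hd⟩ := exists_numbering (U := (⋃ l, pushed (P.code l)) ∪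
    (Set.range (fun b => (⟨i.k, i.e.symm b⟩ : Sigma Γ)) ∪
      Set.range fun b => (⟨o.k, o.e.symm b⟩ : Sigma Γ)))
    ((Set.finite_iUnion fun l => finite_pushed _).union
      ((Set.finite_range _).union (Set.finite_range _)))
  set U := (⋃ l, pushed (P.code l)) ∪
    (Set.range (fun b => (⟨i.k, i.e.symm b⟩ : Sigma Γ)) ∪
      Set.range fun b => (⟨o.k, o.e.symm b⟩ : Sigma Γ))
  refine ⟨⟨k, g, l, t, fun j => translate a b s s.symm e d (P.code (b.symm j)), b P.main, s v,
    a i.k, a o.k, fun c => e ⟨i.k, i.e.symm c⟩, fun c => e ⟨o.k, o.e.symm c⟩⟩,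
    fun zs => ⟨fun c c' h => ?_, ?_⟩⟩
  · have hc := hd o.k (o.e.symm c) (.inr (.inr ⟨c, rfl⟩))
    have hc' := hd o.k (o.e.symm c') (.inr (.inr ⟨c', rfl⟩))
    simp only at h
    rw [h, hc'] at hc
    exact (o.e.symm.injective (Option.some.inj hc)).symm
  · obtain ⟨n, -, hn⟩ := hP zs
    obtain ⟨⟨_, _, T⟩, hT, h₁, rfl, h₃⟩ := hn.simulate
      (g := TM2.step fun j => translate a b s s.symm e d (P.code (b.symm j)))
      (R := fun c c' => c'.l = c.l.map b ∧ c'.var = s c.var ∧ StackRel a e U c.stk c'.stk)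
      (by
        rintro ⟨_ | l, v, S⟩ ⟨_, _, S'⟩ c' ⟨rfl, rfl, h⟩ hc
        · simp at hc
        · simp only [TM2.step, Option.some.injEq] at hc
          subst hc
          obtain ⟨T, hT, h'⟩ := stepAux_translate (b := b) (s' := s.symm) a.injective
            s.symm_apply_apply hd (P.code l)
            ((Set.subset_iUnion (fun l => pushed (P.code l)) l).trans Set.subset_union_left)
            v S S' h
          refine ⟨⟨_, _, T⟩, ?_, rfl, rfl, h'⟩
          refine Eq.trans ?_ (congrArg some hT)
          simp)
      (b := ⟨some (b P.main), s v, Function.update (fun _ => []) (a i.k)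
        ((encodeTuple zs).map fun c => e ⟨i.k, i.e.symm c⟩)⟩) ⟨rfl, rfl, by
          have h : StackRel a e U (fun _ => []) (fun _ => []) := fun k => by simp
          have h' := h.update a.injective i.k (L := (encodeTuple zs).map i.e.symm)
            fun γ hγ => by
              obtain ⟨c, -, rfl⟩ := List.mem_map.1 hγ
              exact .inr (.inl ⟨c, rfl⟩)
          rw [List.map_map] at h'
          exact h'⟩
    simp only at h₁ h₃
    subst h₁
    refine ⟨n, _, T, hT, ?_⟩
    rw [(h₃ o.k).1]
    simp [put, Function.comp_def]

/-- A numerical machine determines the function that it computes, and there are countably many such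
machines. -/
theorem countable_polyTimeComputable : {f : List Str → Str | PolyTimeComputable f}.Countable := by
  choose M hM using fun f : {f : List Str → Str | PolyTimeComputable f} => exists_numMachine f.2
  have : Function.Injective M := fun f f' h =>
    Subtype.ext <| funext fun zs => (hM f zs).unique (h ▸ hM f' zs)
  exact this.countable

/-! ### The four non-inclusions -/

open Classical in
theorem not_interClass_subset : ¬ interClass PSel PSel ⊆ PMcConst 2 := by
  refine not_subset_PMcConst (𝒞 := interClass PSel PSel) 
    countable_polyTimeComputable and
    (fun A hA B hB => ⟨A, hA, B, hB, ?_⟩) 2 (by decide) ?_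
  · ext w
    simp
  · intro t ht
    obtain ⟨a, b, rfl⟩ := List.length_eq_two.1 ht
    -- The two cuts give the patterns 00, 10, 11 and 00, 01, 11 on two probes; their conjunctions
    -- cover all four patterns.
    revert a b
    decide

open Classical in
theorem not_unionClass_subset : ¬ unionClass PSel PSel ⊆ PMcConst 2 := by
  refine not_subset_PMcConst (𝒞 := unionClass PSel PSel) 
    countable_polyTimeComputable or
    (fun A hA B hB => ⟨A, hA, B, hB, ?_⟩) 2 (by decide) ?_
  · ext w
    simp
  · intro t ht
    obtain ⟨a, b, rfl⟩ := List.length_eq_two.1 ht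
    revert a b
    decide

open Classical in
theorem not_xorClass_subset : ¬ xorClass PSel PSel ⊆ PMcConst 3 := by
  refine not_subset_PMcConst (𝒞 := xorClass PSel PSel) 
    countable_polyTimeComputable xor
    (fun A hA B hB => ⟨A, hA, B, hB, ?_⟩) 3 le_rfl ?_
  · ext w
    by_cases h : w ∈ A <;> by_cases h' : w ∈ B <;> simp [h, h']
  · intro t ht
    obtain ⟨a, b, c, rfl⟩ := List.length_eq_three.1 ht
    -- For each of the eight patterns, one of the sixteen blocks gives two thresholds whose xor is
    -- that pattern.
    revert a b c
    decide

open Classical in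
theorem not_nxorClass_subset : ¬ nxorClass PSel PSel ⊆ PMcConst 3 := by
  refine not_subset_PMcConst (𝒞 := nxorClass PSel PSel) 
    countable_polyTimeComputable (fun a b => !xor a b)
    (fun A hA B hB => ⟨A, hA, B, hB, ?_⟩) 3 le_rfl ?_
  · ext w
    by_cases h : w ∈ A <;> by_cases h' : w ∈ B <;> simp [h, h']
  · intro t ht
    obtain ⟨a, b, c, rfl⟩ := List.length_eq_three.1 ht
    revert a b c
    decide

end Selectivity

theorem mainTheorem7 :
    (Selectivity.interClass Selectivity.PSel Selectivity.PSel ⊆ Selectivity.PMcConst 3 ∧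
      ¬ Selectivity.interClass Selectivity.PSel Selectivity.PSel ⊆ Selectivity.PMcConst 2) ∧
    (Selectivity.unionClass Selectivity.PSel Selectivity.PSel ⊆ Selectivity.PMcConst 3 ∧
      ¬ Selectivity.unionClass Selectivity.PSel Selectivity.PSel ⊆ Selectivity.PMcConst 2) ∧
    (¬ Selectivity.xorClass Selectivity.PSel Selectivity.PSel ⊆ Selectivity.PMcConst 3 ∧
      ¬ Selectivity.nxorClass Selectivity.PSel Selectivity.PSel ⊆ Selectivity.PMcConst 3) :=
  ⟨⟨Selectivity.interClass_subset, Selectivity.not_interClass_subset⟩,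
    ⟨Selectivity.unionClass_subset, Selectivity.not_unionClass_subset⟩,
    Selectivity.not_xorClass_subset, Selectivity.not_nxorClass_subset⟩
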